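/- Let $k\ge 0$ be an integer. Write $h_n=\sum_{i=1}^{n}\frac1{2i-1}$; for integers $r,n\ge0$ let $t_r(n)$ be the Milgram constants $$t_r(n)=\sum_{m_n=0}^{r}\frac1{m_n+\frac n2}\sum_{m_{n-1}=0}^{m_n}\frac1{m_{n-1}+\frac{n-1}2}\cdots\sum_{m_1=0}^{m_2}\frac1{m_1+\frac12},$$ so that $t_n(0)=1$ (empty nested sum); let $\psi^{(m)}$ be the $m$-th derivative of $\psi^{(0)}=\Gamma'/\Gamma$ on $(0,\infty)$, $\zeta$ the Riemann zeta function, $\beta(s)=\sum_{n\ge1}\frac{(-1)^{n+1}}{(2n-1)^s}$ and $\mathrm{Li}_s(z)=\sum_{n\ge1}\frac{z^n}{n^s}$. Then all the series below converge (in each double series the inner sum over $j$ is taken first) and $$\begin{aligned} \sum_{n=1}^{\infty}\frac{2(-1)^{n+1}h_n}{(2n+2k)^3} ={}&\sum_{n=0}^{\infty}\sum_{j=0}^{\infty}\frac{(-1)^{n+j}t_n(0)}{(n+\frac12)(2n+2j+2k+2)^3}\\ ={}&\sum_{j=1}^{k}\frac{(-1)^{j+1}}{64(1+2k-2j)^3}\Bigl(32\pi-32\psi^{(0)}\bigl(\tfrac{k+2-j}2\bigr)+32\psi^{(0)}\bigl(\tfrac{1+k-j}2\bigr)\\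 &\quad+8(1+2k-2j)\psi^{(1)}\bigl(\tfrac{k+2-j}2\bigr)-8(1+2k-2j)\psi^{(1)}\bigl(\tfrac{1+k-j}2\bigr)\\ &\quad-(1+2k-2j)^2\bigl(\psi^{(2)}\bigl(\tfrac{k+2-j}2\bigr)-\psi^{(2)}\bigl(\tfrac{1+k-j}2\bigr)\bigr)\Bigr)\\ &+(-1)^k\Bigl[\tfrac12\Bigl(\tfrac{11}4\zeta(4)-\tfrac74\zeta(3)\ln2+\tfrac12\zeta(2)\ln^22-\tfrac1{12}\ln^42-2\,\mathrm{Li}_4\bigl(\tfrac12\bigr)\Bigr)-\tfrac{25}{128}\zeta(4)\Bigr], \end{aligned}$$ $$\begin{aligned} \sum_{n=1}^{\infty}\frac{2(-1)^{n+1}h_n}{(2n+2k+1)^3} ={}&\sum_{n=0}^{\infty}\sum_{j=0}^{\infty}\frac{(-1)^{n+j}t_n(0)}{(n+\frac12)(2n+2j+2k+3)^3}\\ ={}&\sum_{j=1}^{k}\frac{(-1)^{j+1}}{512(1+k-j)^3}\Bigl(32\pi-32\psi^{(0)}\bigl(\tfrac{2k+5-2j}4\bigr)+32\psi^{(0)}\bigl(\tfrac{3+2k-2j}4\bigr)\\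 &\quad+16(1+k-j)\bigl(\psi^{(1)}\bigl(\tfrac{2k+5-2j}4\bigr)-\psi^{(1)}\bigl(\tfrac{3+2k-2j}4\bigr)\bigr)\\ &\quad-4(1+k-j)^2\bigl(\psi^{(2)}\bigl(\tfrac{2k+5-2j}4\bigr)-\psi^{(2)}\bigl(\tfrac{3+2k-2j}4\bigr)\bigr)\Bigr)\\ &+(-1)^k\Bigl(\tfrac{7\pi}{64}\zeta(3)+\beta(4)-\tfrac{\pi^3}{16}\ln2\Bigr). \end{aligned}$$ -/

import Mathlib

namespace EulerSums

noncomputable section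

/-- The odd harmonic number `h_n = ∑_{i=1}^{n} 1 / (2 i - 1)`. -/
def oddHarmonic (n : ℕ) : ℝ :=
  ∑ i ∈ Finset.range n, 1 / (2 * (i : ℝ) + 1)

/-- The Milgram constant `t_k(n)`, where `milgram n k` is `t_k(n)`: the `n`-fold nested sum
`∑_{m_n=0}^{k} 1/(m_n + n/2) ∑_{m_{n-1}=0}^{m_n} 1/(m_{n-1} + (n-1)/2) ⋯ ∑_{m_1=0}^{m_2} 1/(m_1 + 1/2)`.
The empty nested sum is `t_k(0) = 1`. -/
def milgram : ℕ → ℕ → ℝ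
  | 0, _ => 1
  | n + 1, k => ∑ m ∈ Finset.range (k + 1), 1 / ((m : ℝ) + ((n : ℝ) + 1) / 2) * milgram n m

/-- The polygamma function `ψ^{(m)}`, the `m`-th derivative of `ψ = Γ' / Γ` on the reals. -/
def polygamma (m : ℕ) (x : ℝ) : ℝ :=
  iteratedDeriv m (logDeriv Real.Gamma) x

/-- The (real) value `ζ(s)` of the Riemann zeta function at a natural number `s`. -/
def zetaValue (s : ℕ) : ℝ :=
  (riemannZeta (s : ℂ)).re

/-- The Dirichlet beta value `β(s) = ∑_{n ≥ 1} (-1)^{n+1} / (2 n - 1)^s`, used for `s ≥ 2`. -/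
def dirichletBeta (s : ℕ) : ℝ :=
  ∑' n : ℕ, (-1 : ℝ) ^ n / (2 * (n : ℝ) + 1) ^ s

/-- The polylogarithm `Li_s(z) = ∑_{n ≥ 1} z^n / n^s`, used for `s ≥ 2` and `|z| ≤ 1`. -/
def polylog (s : ℕ) (z : ℝ) : ℝ :=
  ∑' n : ℕ, z ^ (n + 1) / ((n : ℝ) + 1) ^ s

end

end EulerSums

open Filter Topology Set

namespace EulerSums

noncomputable section

/-! Put S(t) = ∑ (-1)^n 2 h_{n+1} / (2n+t)^3. The double series converges absolutely; along n + j =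
N its sign and its cube are constant and ∑ 1/(i+1/2) = 2 h_{N+1}, so summing by diagonals gives S(t)
and summing by rows gives the iterated series. Since h_{n+1} = h_n + 1/(2n+1), a shift of the index
gives S(t+2) = V(t) - S(t) with V(t) = ∑ 2 (-1)^n / ((2n+1)(2n+t)^3), and partial fractions express
V(t) by π and by half-step differences of polygamma functions (`hasSum_stepValue`). Iterating k
times from t = 2 and t = 3 produces the finite sums and leaves two constants, S(2) and S(3).

S(2) is -1/4 times ∑ (-1)^n h_n / n^3. Because ∑ h_n z^{2n} / n = log² w / 4 with w = (1-z)/(1+z),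
and z ↦ w is an involution, a combination of the weight-three series at z² and w² is constant
(`hasDerivAt_cayleyInvariant`). Comparing z = i with z = 1 reduces S(2) to ∑ h_n / n^3, hence to the
sums ∑ (±1)^n H_{n-1} / n^3. The plus sign is Euler's ζ(3,1) = ζ(4)/4 (`nielsen_three_one`). The
minus sign follows from the reflection z ↦ 1-z, which fixes 1/2, and the Landen map z ↦ -z/(1-z),
which carries 1/2 to -1; this is where Li_4(1/2) enters (`nielsen_three_neg_one_eq`).

S(3) comes from one absolutely convergent double series, `mixedTerm`, summed in both orders: one
order produces h_n, log 2 and β(4), the other uses Leibniz's series and gives π ζ(3)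
(`tsum_oddHarmonic_odd_cube`). -/

/-- The power series with coefficients `a`, as a function. -/
def powerSum {𝕜 : Type*} [RCLike 𝕜] (a : ℕ → 𝕜) (z : 𝕜) : 𝕜 := ∑' n, a n * z ^ n

/-! ### Power series with bounded coefficients -/

section General
variable {𝕜 : Type*} [RCLike 𝕜]

theorem powerSum_zero (a : ℕ → 𝕜) : powerSum a 0 = a 0 := by
  unfold powerSum
  rw [tsum_eq_single 0]
  · simp
  · intro n hn; simp [hn]

theorem summable_powerSum {a : ℕ → 𝕜} {C : ℝ} (ha : ∀ n, ‖a n‖ ≤ C * n + C) {z : 𝕜} (hz : ‖z‖ < 1) :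
    Summable fun n => a n * z ^ n := by
  have h1 : Summable fun n : ℕ => ((n : ℝ) ^ 1 * ‖z‖ ^ n) :=
    summable_pow_mul_geometric_of_norm_lt_one 1 (by simpa using hz)
  have h0 : Summable fun n : ℕ => (‖z‖ ^ n) := summable_geometric_of_lt_one (norm_nonneg _) hz
  refine Summable.of_norm_bounded ((h1.mul_left C).add (h0.mul_left C)) fun n => ?_
  rw [norm_mul, norm_pow]
  calc ‖a n‖ * ‖z‖ ^ n ≤ (C * n + C) * ‖z‖ ^ n := by gcongr; exact ha n
    _ = _ := by ring

theorem hasDerivAt_powerSum {a : ℕ → 𝕜} (ha : ∀ n, ‖a n‖ ≤ 1) {z : 𝕜} (hz : ‖z‖ < 1) :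
    HasDerivAt (powerSum a) (powerSum (fun n => (n + 1) * a (n + 1)) z) z := by
  obtain ⟨r, hzr, hr⟩ := exists_between hz
  have hr0 : 0 ≤ r := (norm_nonneg z).trans hzr.le
  have h1 : Summable fun n : ℕ => ((n : ℝ) ^ 1 * r ^ (n - 1)) := by
    rw [← summable_nat_add_iff 1]
    have h1 : Summable fun n : ℕ => ((n : ℝ) ^ 1 * r ^ n) :=
      summable_pow_mul_geometric_of_norm_lt_one 1 (by rwa [Real.norm_of_nonneg hr0])
    have h0 : Summable fun n : ℕ => (r ^ n) := summable_geometric_of_lt_one hr0 hr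
    refine (h1.add h0).congr fun n => ?_
    rw [Nat.add_sub_cancel]
    push_cast
    ring
  have key := hasDerivAt_tsum_of_isPreconnected (𝕜 := 𝕜) (F := 𝕜)
    (g := fun n z => a n * z ^ n) (g' := fun n z => a n * (n * z ^ (n - 1)))
    (t := Metric.ball 0 r) (y₀ := 0) (y := z) h1 Metric.isOpen_ball
    (convex_ball (0 : 𝕜) r).isPreconnected
    (fun n y _ => (hasDerivAt_pow n y).const_mul (a n)) (fun n y hy => ?_)
    (Metric.mem_ball_self ((norm_nonneg z).trans_lt hzr)) ?_ (by simpa using hzr)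
  · suffices h : powerSum (fun n => (n + 1) * a (n + 1)) z = ∑' n, a n * (n * z ^ (n - 1)) by
      rw [h]; exact key
    unfold powerSum
    have hs : Summable fun n : ℕ => a n * (n * z ^ (n - 1)) := by
      refine Summable.of_norm_bounded h1 fun n => ?_
      rw [norm_mul, norm_mul, norm_pow, RCLike.norm_natCast]
      calc ‖a n‖ * (n * ‖z‖ ^ (n - 1)) ≤ 1 * (n * r ^ (n - 1)) := by
            gcongr; exact ha n
        _ = _ := by ring
    rw [hs.tsum_eq_zero_add]
    simp only [Nat.cast_zero, zero_mul, mul_zero, zero_add, Nat.cast_add, Nat.cast_one,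
      add_tsub_cancel_right]
    exact tsum_congr fun n => by ring
  · rw [norm_mul, norm_mul, norm_pow, RCLike.norm_natCast]
    have : ‖y‖ ≤ r := by simpa using (Metric.mem_ball.1 hy).le
    calc ‖a n‖ * (n * ‖y‖ ^ (n - 1)) ≤ 1 * (n * r ^ (n - 1)) := by
          gcongr; exact ha n
      _ = _ := by ring
  · exact summable_powerSum (C := 1) (fun n => (ha n).trans (by
      have : (0 : ℝ) ≤ n := n.cast_nonneg
      linarith)) (by simp)

/-- The operator z d/dz multiplies the n-th coefficient by n, so it lowers the exponent k of `1 / n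
^ k` by one. This rule differentiates all the series of polylogarithm type below. -/
theorem hasDerivAt_powerSum_div {a b : ℕ → 𝕜} (ha : ∀ n, ‖a n‖ ≤ 1) (hab : ∀ n, b n = n * a n)
    {z : 𝕜} (hz : ‖z‖ < 1) (hz0 : z ≠ 0) :
    HasDerivAt (powerSum a) (powerSum b z / z) z := by
  convert hasDerivAt_powerSum ha hz using 1
  rw [div_eq_iff hz0]
  unfold powerSum
  have hs : Summable fun n : ℕ => b n * z ^ n := by
    refine summable_powerSum (C := 1) (fun n => ?_) hz
    rw [hab, norm_mul, RCLike.norm_natCast]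
    have : (0 : ℝ) ≤ n := n.cast_nonneg
    nlinarith [ha n]
  rw [hs.tsum_eq_zero_add, ← tsum_mul_right]
  simp only [hab, Nat.cast_zero, zero_mul, zero_add, Nat.cast_add, Nat.cast_one]
  exact tsum_congr fun n => by ring

theorem continuousOn_powerSum {a : ℕ → 𝕜} (ha : Summable fun n => ‖a n‖) :
    ContinuousOn (powerSum a) (Metric.closedBall 0 1) := by
  refine continuousOn_tsum (fun n => by fun_prop) ha fun n z hz => ?_
  rw [norm_mul, norm_pow]
  have : ‖z‖ ≤ 1 := by simpa using hz
  calc ‖a n‖ * ‖z‖ ^ n ≤ ‖a n‖ * 1 := by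
        gcongr; exact pow_le_one₀ (norm_nonneg _) this
    _ = _ := mul_one _

/-- The generating function of partial sums. -/
theorem powerSum_partialSum {c : ℕ → 𝕜} (hc : ∀ n, ‖c n‖ ≤ 1) {z : 𝕜} (hz : ‖z‖ < 1) :
    (1 - z) * powerSum (fun n => ∑ i ∈ Finset.range (n + 1), c i) z = powerSum c z := by
  have hb : ∀ n, ‖∑ i ∈ Finset.range n, c i‖ ≤ n := fun n =>
    (norm_sum_le _ _).trans ((Finset.sum_le_sum fun i _ => hc i).trans (by simp))
  have h1 : Summable fun n => (∑ i ∈ Finset.range (n + 1), c i) * z ^ n :=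
    summable_powerSum (C := 1) (fun n => (hb _).trans (by push_cast; linarith)) hz
  have h0 : Summable fun n => (∑ i ∈ Finset.range n, c i) * z ^ n :=
    summable_powerSum (C := 1) (fun n => (hb _).trans (by linarith)) hz
  unfold powerSum
  rw [sub_mul, one_mul, ← tsum_mul_left]
  have h2 : ∑' n, z * ((∑ i ∈ Finset.range (n + 1), c i) * z ^ n)
      = ∑' n, (∑ i ∈ Finset.range n, c i) * z ^ n := by
    rw [h0.tsum_eq_zero_add]
    simp only [Finset.range_zero, Finset.sum_empty, zero_mul, zero_add]
    exact tsum_congr fun n => by ring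
  rw [h2, ← h1.tsum_sub h0]
  exact tsum_congr fun n => by rw [Finset.sum_range_succ]; ring

end General

/-! ### Growth of harmonic-type partial sums -/

section PartialSums

/-- A crude substitute for logarithmic growth: 1/(n+1) ≤ 2(√(n+1) - √n) telescopes. A bound of order
√n already makes division by n² summable. -/
theorem partialSum_le_sqrt {c : ℕ → ℝ} (hc : ∀ i, c i ≤ 2 / ((i : ℝ) + 1)) (n : ℕ) :
    ∑ i ∈ Finset.range n, c i ≤ 4 * √n := by
  induction n with
  | zero => simp
  | succ n ih =>
    rw [Finset.sum_range_succ]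
    have h1 : 1 / ((n : ℝ) + 1) ≤ 2 * (√(n + 1) - √n) := by
      have ha : 0 ≤ √(n : ℝ) := Real.sqrt_nonneg _
      have hb : √(n : ℝ) ≤ √(n + 1) := Real.sqrt_le_sqrt (by linarith)
      have hb1 : 1 ≤ √((n : ℝ) + 1) := by
        rw [Real.one_le_sqrt]; linarith [(n.cast_nonneg : (0 : ℝ) ≤ n)]
      have ha2 := Real.sq_sqrt (n.cast_nonneg : (0 : ℝ) ≤ n)
      have hb2 := Real.sq_sqrt (by positivity : (0 : ℝ) ≤ n + 1)
      set A := √(n : ℝ)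
      set B := √((n : ℝ) + 1)
      rw [← hb2, div_le_iff₀ (by positivity)]
      have h3 : 1 = (B - A) * (B + A) := by nlinarith
      have h4 : 0 ≤ B - A := by linarith
      have h5 : B + A ≤ 2 * B ^ 2 := by nlinarith
      calc (1 : ℝ) = (B - A) * (B + A) := h3
        _ ≤ (B - A) * (2 * B ^ 2) := by gcongr
        _ = _ := by ring
    have h2 := hc n
    have : 2 / ((n : ℝ) + 1) = 2 * (1 / ((n : ℝ) + 1)) := by ring
    push_cast
    linarith

theorem summable_partialSum_div {c : ℕ → ℝ} (h0 : ∀ i, 0 ≤ c i) (hc : ∀ i, c i ≤ 2 / ((i : ℝ) + 1))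
    {k : ℕ} (hk : 2 ≤ k) :
    Summable fun n : ℕ => (∑ i ∈ Finset.range n, c i) / (n : ℝ) ^ k := by
  have hs : Summable fun n : ℕ => 4 * (1 / (n : ℝ) ^ (3 / 2 : ℝ)) :=
    (Real.summable_one_div_nat_rpow.2 (by norm_num)).mul_left 4
  refine Summable.of_nonneg_of_le (fun n => div_nonneg (Finset.sum_nonneg fun i _ => h0 i)
    (by positivity)) (fun n => ?_) hs
  rcases n.eq_zero_or_pos with rfl | hn
  · simp
  have hn1 : (1 : ℝ) ≤ n := by exact_mod_cast hn
  have hn0 : (0 : ℝ) < n := by linarith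
  calc (∑ i ∈ Finset.range n, c i) / (n : ℝ) ^ k ≤ 4 * √n / (n : ℝ) ^ 2 := by
        gcongr
        exact partialSum_le_sqrt hc n
    _ = 4 * (1 / (n : ℝ) ^ (3 / 2 : ℝ)) := by
        have : (n : ℝ) ^ 2 = (n : ℝ) ^ (3 / 2 : ℝ) * √n := by
          rw [Real.sqrt_eq_rpow, ← Real.rpow_add hn0, ← Real.rpow_natCast]; norm_num
        rw [this]
        have h1 : (n : ℝ) ^ (3 / 2 : ℝ) ≠ 0 := by positivity
        have h2 : √(n : ℝ) ≠ 0 := by positivity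
        field_simp

end PartialSums

/-- The pattern behind the real functional equations below: the combination has derivative zero, and
its constant is read off from a one-sided limit at an endpoint where the logarithms may be singular.
-/
theorem eq_of_hasDerivAt_zero {E : Type*} [NormedAddCommGroup E] [NormedSpace ℝ E] {f : ℝ → E}
    {a b : ℝ} (hf : ∀ t ∈ Ioo a b, HasDerivAt f 0 t) {A : E} (hA : Tendsto f (𝓝[>] a) (𝓝 A))
    {t : ℝ} (ht : t ∈ Ioo a b) : f t = A := by
  have hc : ∀ s ∈ Ioo a b, f s = f t := fun s hs =>
    isOpen_Ioo.is_const_of_deriv_eq_zero isPreconnected_Ioo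
      (fun x hx => (hf x hx).differentiableAt.differentiableWithinAt)
      (fun x hx => (hf x hx).deriv) hs ht
  have h2 : Tendsto f (𝓝[>] a) (𝓝 (f t)) := by
    refine tendsto_const_nhds.congr' ?_
    filter_upwards [Ioo_mem_nhdsGT (ht.1.trans ht.2)] with s hs using (hc s hs).symm
  exact tendsto_nhds_unique h2 hA

theorem limits_eq_of_hasDerivAt_zero {E : Type*} [NormedAddCommGroup E] [NormedSpace ℝ E]
    {f : ℝ → E} {a b : ℝ} (hab : a < b)
    (hf : ∀ t ∈ Ioo a b, HasDerivAt f 0 t) {A B : E} (hA : Tendsto f (𝓝[>] a) (𝓝 A))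
    (hB : Tendsto f (𝓝[<] b) (𝓝 B)) : A = B := by
  refine tendsto_nhds_unique ?_ hB
  refine tendsto_const_nhds.congr' ?_
  filter_upwards [Ioo_mem_nhdsLT hab] with s hs
  exact (eq_of_hasDerivAt_zero hf hA hs).symm

/-! ### Polylogarithms and Nielsen polylogarithms on the real interval -/

/-- The polylogarithm as a power series with coefficients `1 / n ^ k` (and `1 / 0 = 0`). -/
def liSeries (k : ℕ) : ℝ → ℝ := powerSum fun n : ℕ => 1 / (n : ℝ) ^ k

/-- The sum of `1 / i` over `0 < i < n`. -/
def harmonicPred (n : ℕ) : ℝ := ∑ i ∈ Finset.range n, 1 / (i : ℝ)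

/-- The Nielsen polylogarithm `∑ H_{n-1} z ^ n / n ^ k`. -/
def nielsen (k : ℕ) : ℝ → ℝ := powerSum fun n : ℕ => harmonicPred n / (n : ℝ) ^ k

theorem one_div_nat_le_one (n : ℕ) : 1 / (n : ℝ) ≤ 1 := by
  rcases n.eq_zero_or_pos with rfl | hn
  · simp
  · rw [div_le_one (by exact_mod_cast hn)]; exact_mod_cast hn

theorem one_div_nat_le (n : ℕ) : 1 / (n : ℝ) ≤ 2 / ((n : ℝ) + 1) := by
  rcases n.eq_zero_or_pos with rfl | hn
  · simp
  · have : (1 : ℝ) ≤ n := by exact_mod_cast hn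
    rw [div_le_div_iff₀ (by linarith) (by linarith)]
    linarith

theorem harmonicPred_nonneg (n : ℕ) : 0 ≤ harmonicPred n :=
  Finset.sum_nonneg fun i _ => by positivity

theorem harmonicPred_le (n : ℕ) : harmonicPred n ≤ n :=
  (Finset.sum_le_sum fun i _ => one_div_nat_le_one i).trans (by simp)

theorem summable_harmonicPred_div {k : ℕ} (hk : 2 ≤ k) :
    Summable fun n : ℕ => harmonicPred n / (n : ℝ) ^ k :=
  summable_partialSum_div (fun i => by positivity) one_div_nat_le hk

theorem norm_one_div_pow_le (k n : ℕ) : ‖1 / (n : ℝ) ^ k‖ ≤ 1 := by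
  rw [Real.norm_of_nonneg (by positivity)]
  calc 1 / (n : ℝ) ^ k = (1 / (n : ℝ)) ^ k := by rw [one_div_pow]
    _ ≤ 1 := pow_le_one₀ (by positivity) (one_div_nat_le_one n)

theorem norm_harmonicPred_div_le {k : ℕ} (hk : 1 ≤ k) (n : ℕ) :
    ‖harmonicPred n / (n : ℝ) ^ k‖ ≤ 1 := by
  rw [Real.norm_of_nonneg (div_nonneg (harmonicPred_nonneg n) (by positivity))]
  rcases n.eq_zero_or_pos with rfl | hn
  · simp [harmonicPred]
  have h1 : (1 : ℝ) ≤ n := by exact_mod_cast hn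
  rw [div_le_one (by positivity)]
  exact (harmonicPred_le n).trans (le_self_pow₀ h1 (by omega))

theorem hasDerivAt_liSeries (k : ℕ) {z : ℝ} (hz : |z| < 1) (hz0 : z ≠ 0) :
    HasDerivAt (liSeries (k + 2)) (liSeries (k + 1) z / z) z := by
  refine hasDerivAt_powerSum_div (norm_one_div_pow_le _) (fun n => ?_) hz hz0
  rcases n.eq_zero_or_pos with rfl | hn
  · simp
  have h1 : (n : ℝ) ≠ 0 := by positivity
  field_simp
  ring

theorem hasDerivAt_nielsen (k : ℕ) {z : ℝ} (hz : |z| < 1) (hz0 : z ≠ 0) :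
    HasDerivAt (nielsen (k + 2)) (nielsen (k + 1) z / z) z := by
  refine hasDerivAt_powerSum_div (norm_harmonicPred_div_le (by omega)) (fun n => ?_) hz hz0
  rcases n.eq_zero_or_pos with rfl | hn
  · simp
  have h1 : (n : ℝ) ≠ 0 := by positivity
  field_simp
  ring

theorem liSeries_one {z : ℝ} (hz : |z| < 1) : liSeries 1 z = -Real.log (1 - z) := by
  have h := Real.hasSum_pow_div_log_of_abs_lt_one hz
  have h2 : HasSum (fun n : ℕ => 1 / (n : ℝ) ^ 1 * z ^ n) (-Real.log (1 - z)) := by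
    rw [← hasSum_nat_add_iff' 1]
    simp only [Finset.range_one, Finset.sum_singleton, pow_one, Nat.cast_zero, div_zero, zero_mul,
      sub_zero]
    have he : (fun n : ℕ => 1 / ((n + 1 : ℕ) : ℝ) * z ^ (n + 1))
        = fun n : ℕ => z ^ (n + 1) / ((n : ℝ) + 1) := by
      funext n; push_cast; ring
    simpa only [he, pow_one] using h
  exact h2.tsum_eq

theorem nielsen_one {z : ℝ} (hz : |z| < 1) : nielsen 1 z = Real.log (1 - z) ^ 2 / 2 := by
  have hd : ∀ y ∈ Metric.ball (0 : ℝ) 1,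
      HasDerivAt (nielsen 1) (-Real.log (1 - y) / (1 - y)) y := by
    intro y hy
    have hy' : |y| < 1 := by simpa using hy
    have h1 : 1 - y ≠ 0 := by linarith [(abs_lt.1 hy').2]
    refine (hasDerivAt_powerSum (norm_harmonicPred_div_le le_rfl) hy').congr_deriv ?_
    rw [eq_div_iff h1, ← liSeries_one hy', mul_comm]
    -- The n-th coefficient of the derivative is the sum of 1/i over i ≤ n, where i = 0 contributes
    -- nothing by `1 / 0 = 0`; so multiplying by 1 - y gives the logarithm series.
    have h2 := powerSum_partialSum (c := fun n : ℕ => 1 / (n : ℝ) ^ 1) (norm_one_div_pow_le 1) hy'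
    rw [liSeries, ← h2]
    congr 2
    funext n
    have h3 : (n : ℝ) + 1 ≠ 0 := by positivity
    simp only [harmonicPred, pow_one]
    push_cast
    field_simp
  have hd2 : ∀ y ∈ Metric.ball (0 : ℝ) 1,
      HasDerivAt (fun z => Real.log (1 - z) ^ 2 / 2) (-Real.log (1 - y) / (1 - y)) y := by
    intro y hy
    have hy' : |y| < 1 := by simpa using hy
    have h1 : 1 - y ≠ 0 := by linarith [(abs_lt.1 hy').2]
    refine ((((hasDerivAt_id y).const_sub 1).log h1).pow 2 |>.div_const 2).congr_deriv ?_
    simp; field_simp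
  refine Metric.isOpen_ball.eqOn_of_deriv_eq (convex_ball (0 : ℝ) 1).isPreconnected
    (fun y hy => (hd y hy).differentiableAt.differentiableWithinAt)
    (fun y hy => (hd2 y hy).differentiableAt.differentiableWithinAt)
    (fun y hy => (hd y hy).deriv.trans (hd2 y hy).deriv.symm)
    (Metric.mem_ball_self one_pos) ?_ (by simpa using hz)
  simp [nielsen, powerSum_zero, harmonicPred]

theorem continuousOn_liSeries {k : ℕ} (hk : 2 ≤ k) :
    ContinuousOn (liSeries k) (Icc (-1) 1) := by
  have h := continuousOn_powerSum (a := fun n : ℕ => 1 / (n : ℝ) ^ k)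
    (by simpa using (Real.summable_one_div_nat_pow.2 (by omega : 1 < k)))
  rw [Real.closedBall_eq_Icc] at h
  simpa [liSeries] using h

theorem continuousOn_nielsen {k : ℕ} (hk : 2 ≤ k) :
    ContinuousOn (nielsen k) (Icc (-1) 1) := by
  have h := continuousOn_powerSum (a := fun n : ℕ => harmonicPred n / (n : ℝ) ^ k)
    (summable_harmonicPred_div hk).norm
  rw [Real.closedBall_eq_Icc] at h
  simpa [nielsen] using h

theorem liSeries_zero (k : ℕ) : liSeries (k + 1) 0 = 0 := by simp [liSeries, powerSum_zero]

theorem nielsen_zero (k : ℕ) : nielsen k 0 = 0 := by simp [nielsen, powerSum_zero, harmonicPred]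

theorem zetaValue_eq {k : ℕ} (hk : 2 ≤ k) : zetaValue k = liSeries k 1 := by
  rw [zetaValue, zeta_nat_eq_tsum_of_gt_one (by omega), liSeries, powerSum]
  have : ∑' n : ℕ, 1 / (n : ℂ) ^ k = ((∑' n : ℕ, 1 / (n : ℝ) ^ k : ℝ) : ℂ) := by push_cast; rfl
  rw [this, Complex.ofReal_re]
  simp

theorem polylog_eq {k : ℕ} {z : ℝ} (hz : |z| < 1) : polylog (k + 1) z = liSeries (k + 1) z := by
  have hs : Summable fun n : ℕ => 1 / (n : ℝ) ^ (k + 1) * z ^ n :=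
    summable_powerSum (C := 1) (fun n => (norm_one_div_pow_le _ n).trans (by
      have : (0 : ℝ) ≤ n := n.cast_nonneg
      linarith)) hz
  rw [liSeries, powerSum, hs.tsum_eq_zero_add, polylog]
  simp only [Nat.cast_zero, ne_eq, Nat.add_eq_zero_iff, one_ne_zero, and_false, not_false_eq_true,
    zero_pow, div_zero, zero_mul, zero_add]
  exact tsum_congr fun n => by push_cast; ring

theorem tsum_even_odd_alternating {f : ℕ → ℝ} (hf : Summable f) :
    ∑' n, f n * (-1) ^ n = 2 * ∑' n, f (2 * n) - ∑' n, f n := by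
  have he : Summable fun n => f (2 * n) := hf.comp_injective (mul_right_injective₀ two_ne_zero)
  have ho : Summable fun n => f (2 * n + 1) := hf.comp_injective fun a b h => by simpa using h
  have h1 := tsum_even_add_odd he ho
  have h2 := tsum_even_add_odd (f := fun n => f n * (-1) ^ n)
    (he.congr fun n => by simp [(even_two_mul n).neg_one_pow])
    (ho.neg.congr fun n => by simp [(odd_two_mul_add_one n).neg_one_pow])
  simp only [(even_two_mul _).neg_one_pow, (odd_two_mul_add_one _).neg_one_pow, mul_one,
    mul_neg_one, tsum_neg] at h2
  linear_combination (-1 : ℝ) * h1 - h2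

theorem liSeries_neg_one {k : ℕ} (hk : 2 ≤ k) :
    liSeries k (-1) = -(1 - 2 / 2 ^ k) * liSeries k 1 := by
  have hs : Summable fun n : ℕ => 1 / (n : ℝ) ^ k :=
    Real.summable_one_div_nat_pow.2 hk
  have h := tsum_even_odd_alternating hs
  have h3 : ∑' n : ℕ, 1 / ((2 * n : ℕ) : ℝ) ^ k = 1 / 2 ^ k * ∑' n : ℕ, 1 / (n : ℝ) ^ k := by
    rw [← tsum_mul_left]
    exact tsum_congr fun n => by rw [Nat.cast_mul, mul_pow, Nat.cast_ofNat, one_div_mul_one_div]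
  have h6 : liSeries k 1 = ∑' n : ℕ, 1 / (n : ℝ) ^ k := by simp [liSeries, powerSum]
  rw [h6, liSeries, powerSum, h, h3]
  ring

/-- A function differentiable and vanishing at `0` beats the logarithm there. -/
theorem tendsto_log_mul_of_hasDerivAt {g : ℝ → ℝ} {g' : ℝ} (hg : HasDerivAt g g' 0) (h0 : g 0 = 0) :
    Tendsto (fun z => Real.log z * g z) (𝓝[>] 0) (𝓝 0) := by
  have h1 : g =O[𝓝[>] 0] (fun z : ℝ => z) := by
    simpa [h0] using hg.isBigO_sub.mono nhdsWithin_le_nhds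
  have h2 := (Asymptotics.isBigO_refl Real.log (𝓝[>] 0)).mul h1
  refine h2.trans_tendsto ?_
  simpa using tendsto_log_mul_rpow_nhdsGT_zero one_pos

theorem hasDerivAt_log_one_sub {z : ℝ} (hz : z < 1) :
    HasDerivAt (fun z : ℝ => Real.log (1 - z)) (-1 / (1 - z)) z :=
  ((hasDerivAt_id z).const_sub 1).log (by simp; linarith)

theorem tendsto_log_mul_log_one_sub :
    Tendsto (fun z => Real.log z * Real.log (1 - z)) (𝓝[>] 0) (𝓝 0) :=
  tendsto_log_mul_of_hasDerivAt (hasDerivAt_log_one_sub one_pos) (by simp)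

theorem tendsto_log_one_sub : Tendsto (fun z : ℝ => Real.log (1 - z)) (𝓝[>] 0) (𝓝 0) := by
  have h := (hasDerivAt_log_one_sub one_pos).continuousAt.tendsto.mono_left
    (nhdsWithin_le_nhds (s := Ioi 0))
  simpa using h

theorem tendsto_nhdsGT_zero {g : ℝ → ℝ} (hg : ContinuousOn g (Icc (-1) 1)) :
    Tendsto g (𝓝[>] 0) (𝓝 (g 0)) :=
  (hg.continuousAt (Icc_mem_nhds (by norm_num) (by norm_num))).tendsto.mono_left nhdsWithin_le_nhds

theorem tendsto_one_sub_nhdsGT_zero {g : ℝ → ℝ} (hg : ContinuousOn g (Icc (-1) 1)) :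
    Tendsto (fun z => g (1 - z)) (𝓝[>] 0) (𝓝 (g 1)) := by
  refine (hg 1 (by norm_num)).tendsto.comp ?_
  refine tendsto_nhdsWithin_iff.2 ⟨?_, ?_⟩
  · have : ContinuousAt (fun z : ℝ => 1 - z) 0 := by fun_prop
    simpa using this.tendsto.mono_left (nhdsWithin_le_nhds (s := Ioi 0))
  · filter_upwards [Ioo_mem_nhdsGT (zero_lt_one' ℝ)] with s hs
    constructor <;> linarith [hs.1, hs.2]

/-! ### Reflection formulas under z ↦ 1 - z -/

section Unit
variable {z : ℝ} (hz : z ∈ Ioo (0 : ℝ) 1)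
include hz

theorem abs_lt_one_of_mem : |z| < 1 := by rw [abs_lt]; constructor <;> linarith [hz.1, hz.2]

theorem abs_one_sub_lt_one_of_mem : |1 - z| < 1 := by
  rw [abs_lt]; constructor <;> linarith [hz.1, hz.2]

theorem hasDerivAt_liSeries_two : HasDerivAt (liSeries 2) (-Real.log (1 - z) / z) z := by
  have h := hasDerivAt_liSeries 0 (abs_lt_one_of_mem hz) hz.1.ne'
  rwa [liSeries_one (abs_lt_one_of_mem hz)] at h

theorem hasDerivAt_liSeries_one_sub (k : ℕ) :
    HasDerivAt (fun z => liSeries (k + 2) (1 - z)) (-(liSeries (k + 1) (1 - z) / (1 - z))) z := by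
  have h1 : 1 - z ≠ 0 := by linarith [hz.2]
  have h := (hasDerivAt_liSeries k (abs_one_sub_lt_one_of_mem hz) h1).comp z
    ((hasDerivAt_id z).const_sub 1)
  exact h.congr_deriv (by ring)

theorem hasDerivAt_liSeries_two_one_sub :
    HasDerivAt (fun z => liSeries 2 (1 - z)) (Real.log z / (1 - z)) z := by
  have h := hasDerivAt_liSeries_one_sub hz 0
  rw [liSeries_one (abs_one_sub_lt_one_of_mem hz)] at h
  rw [sub_sub_cancel] at h
  exact h.congr_deriv (by ring)

theorem hasDerivAt_nielsen_two : HasDerivAt (nielsen 2) (Real.log (1 - z) ^ 2 / 2 / z) z := by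
  have h := hasDerivAt_nielsen 0 (abs_lt_one_of_mem hz) hz.1.ne'
  rwa [nielsen_one (abs_lt_one_of_mem hz)] at h

theorem hasDerivAt_nielsen_one_sub (k : ℕ) :
    HasDerivAt (fun z => nielsen (k + 2) (1 - z)) (-(nielsen (k + 1) (1 - z) / (1 - z))) z := by
  have h1 : 1 - z ≠ 0 := by linarith [hz.2]
  have h := (hasDerivAt_nielsen k (abs_one_sub_lt_one_of_mem hz) h1).comp z
    ((hasDerivAt_id z).const_sub 1)
  exact h.congr_deriv (by ring)

theorem hasDerivAt_nielsen_two_one_sub :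
    HasDerivAt (fun z => nielsen 2 (1 - z)) (-(Real.log z ^ 2 / 2 / (1 - z))) z := by
  have h := hasDerivAt_nielsen_one_sub hz 0
  rw [nielsen_one (abs_one_sub_lt_one_of_mem hz)] at h
  rwa [sub_sub_cancel] at h

theorem liSeries_two_reflection :
    liSeries 2 z + liSeries 2 (1 - z) + Real.log z * Real.log (1 - z) = liSeries 2 1 := by
  refine eq_of_hasDerivAt_zero (f := fun z => liSeries 2 z + liSeries 2 (1 - z) +
    Real.log z * Real.log (1 - z)) (fun t ht => ?_) ?_ hz
  · have h1 : 1 - t ≠ 0 := by linarith [ht.2]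
    have h2 : t ≠ 0 := ht.1.ne'
    refine (((hasDerivAt_liSeries_two ht).add (hasDerivAt_liSeries_two_one_sub ht)).add
      ((Real.hasDerivAt_log h2).mul (hasDerivAt_log_one_sub ht.2))).congr_deriv ?_
    field_simp
    ring
  · have h := ((tendsto_nhdsGT_zero (continuousOn_liSeries le_rfl)).add
      (tendsto_one_sub_nhdsGT_zero (continuousOn_liSeries le_rfl))).add tendsto_log_mul_log_one_sub
    simpa [liSeries_zero] using h

/-- This is two integrations by parts of log²(1-z) / (2z), the derivative of `nielsen 2`. -/
theorem nielsen_two_eq :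
    nielsen 2 z + liSeries 3 (1 - z) - Real.log (1 - z) * liSeries 2 (1 - z)
      - Real.log z * Real.log (1 - z) * Real.log (1 - z) / 2 = liSeries 3 1 := by
  refine eq_of_hasDerivAt_zero (f := fun z => nielsen 2 z + liSeries 3 (1 - z) -
    Real.log (1 - z) * liSeries 2 (1 - z)
      - Real.log z * Real.log (1 - z) * Real.log (1 - z) / 2) (fun t ht => ?_) ?_ hz
  · have h1 : 1 - t ≠ 0 := by linarith [ht.2]
    have h2 : t ≠ 0 := ht.1.ne'
    refine ((((hasDerivAt_nielsen_two ht).add (hasDerivAt_liSeries_one_sub ht 1)).sub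
      ((hasDerivAt_log_one_sub ht.2).mul (hasDerivAt_liSeries_two_one_sub ht))).sub
      ((((Real.hasDerivAt_log h2).mul (hasDerivAt_log_one_sub ht.2)).mul
        (hasDerivAt_log_one_sub ht.2)).div_const 2)).congr_deriv ?_
    simp only [Pi.mul_apply]
    field_simp
    ring
  · have h := (((tendsto_nhdsGT_zero (continuousOn_nielsen le_rfl)).add
      (tendsto_one_sub_nhdsGT_zero (continuousOn_liSeries (k := 3) (by norm_num)))).sub
      (tendsto_log_one_sub.mul (tendsto_one_sub_nhdsGT_zero (continuousOn_liSeries le_rfl)))).sub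
      ((tendsto_log_mul_log_one_sub.mul tendsto_log_one_sub).div_const 2)
    simpa [nielsen_zero] using h

/-- Differentiating `nielsen 3 z - log z * nielsen 2 z` leaves only -log z log²(1-z) / (2z).
Together with its mirror image under z ↦ 1 - z this is minus the derivative of (log z log(1-z))² /
4. -/
theorem nielsen_three_reflection :
    nielsen 3 (1 - z) - Real.log (1 - z) * nielsen 2 (1 - z)
      + (Real.log z * Real.log (1 - z)) ^ 2 / 4 - Real.log z * nielsen 2 z + nielsen 3 z
      = nielsen 3 1 := by
  refine eq_of_hasDerivAt_zero (f := fun z => nielsen 3 (1 - z) - Real.log (1 - z) * nielsen 2 (1 - z)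
      + (Real.log z * Real.log (1 - z)) ^ 2 / 4 - Real.log z * nielsen 2 z + nielsen 3 z)
      (fun t ht => ?_) ?_ hz
  · have h1 : 1 - t ≠ 0 := by linarith [ht.2]
    have h2 : t ≠ 0 := ht.1.ne'
    refine (((((hasDerivAt_nielsen_one_sub ht 1).sub
      ((hasDerivAt_log_one_sub ht.2).mul (hasDerivAt_nielsen_two_one_sub ht))).add
      ((((Real.hasDerivAt_log h2).mul (hasDerivAt_log_one_sub ht.2)).pow 2).div_const 4)).sub
      ((Real.hasDerivAt_log h2).mul (hasDerivAt_nielsen_two ht))).add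
      (hasDerivAt_nielsen 1 (abs_lt_one_of_mem ht) h2)).congr_deriv ?_
    simp only [Pi.mul_apply]
    field_simp
    ring
  · have hn : Tendsto (fun z => Real.log z * nielsen 2 z) (𝓝[>] 0) (𝓝 0) :=
      tendsto_log_mul_of_hasDerivAt
        (hasDerivAt_powerSum (norm_harmonicPred_div_le (by norm_num)) (by simp)) (nielsen_zero 2)
    have h := ((((tendsto_one_sub_nhdsGT_zero (continuousOn_nielsen (k := 3) (by norm_num))).sub
      (tendsto_log_one_sub.mul (tendsto_one_sub_nhdsGT_zero (continuousOn_nielsen le_rfl)))).add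
      ((tendsto_log_mul_log_one_sub.pow 2).div_const 4)).sub hn).add
      (tendsto_nhdsGT_zero (continuousOn_nielsen (k := 3) (by norm_num)))
    simpa [nielsen_zero] using h

end Unit

/-! ### Landen's transformation z ↦ -z/(1-z) -/

section Landen
variable {z : ℝ} (hz : z ∈ Ioo (0 : ℝ) (1 / 2))
include hz

theorem mem_unit_of_mem_half : z ∈ Ioo (0 : ℝ) 1 := ⟨hz.1, by linarith [hz.2]⟩

theorem landen_abs_lt_one : |-z / (1 - z)| < 1 := by
  have h1 : 0 < 1 - z := by linarith [hz.2]
  rw [abs_div, abs_neg, abs_of_pos hz.1, abs_of_pos h1, div_lt_one h1]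
  linarith [hz.2]

theorem log_one_sub_landen : Real.log (1 - -z / (1 - z)) = -Real.log (1 - z) := by
  have h1 : 0 < 1 - z := by linarith [hz.2]
  rw [← Real.log_inv]
  congr 1
  field_simp
  ring

theorem hasDerivAt_landen : HasDerivAt (fun z : ℝ => -z / (1 - z)) (-1 / (1 - z) ^ 2) z := by
  have h1 : 1 - z ≠ 0 := by linarith [hz.2]
  refine ((hasDerivAt_id z).neg.div ((hasDerivAt_id z).const_sub 1) h1).congr_deriv ?_
  simp

theorem landen_ne_zero : -z / (1 - z) ≠ 0 := by
  have h1 : 0 < 1 - z := by linarith [hz.2]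
  exact div_ne_zero (neg_ne_zero.2 hz.1.ne') h1.ne'

/-- The logarithmic derivative of -z/(1-z) is 1/(z(1-z)) = 1/z + 1/(1-z). -/
theorem hasDerivAt_liSeries_landen (k : ℕ) :
    HasDerivAt (fun z => liSeries (k + 2) (-z / (1 - z)))
      (liSeries (k + 1) (-z / (1 - z)) / (z * (1 - z))) z := by
  have h1 : 1 - z ≠ 0 := by linarith [hz.2]
  have h2 : z ≠ 0 := hz.1.ne'
  refine ((hasDerivAt_liSeries k (landen_abs_lt_one hz) (landen_ne_zero hz)).comp z
    (hasDerivAt_landen hz)).congr_deriv ?_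
  field_simp

theorem hasDerivAt_nielsen_landen (k : ℕ) :
    HasDerivAt (fun z => nielsen (k + 2) (-z / (1 - z)))
      (nielsen (k + 1) (-z / (1 - z)) / (z * (1 - z))) z := by
  have h1 : 1 - z ≠ 0 := by linarith [hz.2]
  have h2 : z ≠ 0 := hz.1.ne'
  refine ((hasDerivAt_nielsen k (landen_abs_lt_one hz) (landen_ne_zero hz)).comp z
    (hasDerivAt_landen hz)).congr_deriv ?_
  field_simp

end Landen

theorem tendsto_landen_zero {g : ℝ → ℝ} (hg : ContinuousOn g (Icc (-1) 1)) :
    Tendsto (fun z => g (-z / (1 - z))) (𝓝[>] 0) (𝓝 (g 0)) := by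
  have h1 : ContinuousAt g (-0 / (1 - 0)) :=
    hg.continuousAt (Icc_mem_nhds (by norm_num) (by norm_num))
  have h2 : ContinuousAt (fun z : ℝ => -z / (1 - z)) 0 :=
    continuousAt_id.neg.div (continuousAt_const.sub continuousAt_id) (by norm_num)
  have h := (ContinuousAt.comp (f := fun z : ℝ => -z / (1 - z)) (x := 0) h1 h2).tendsto.mono_left
    (nhdsWithin_le_nhds (s := Ioi 0))
  simpa [Function.comp_def] using h

theorem tendsto_landen_half {g : ℝ → ℝ} (hg : ContinuousOn g (Icc (-1) 1)) :
    Tendsto (fun z => g (-z / (1 - z))) (𝓝[<] (1 / 2)) (𝓝 (g (-1))) := by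
  refine (hg (-1) (by norm_num)).tendsto.comp ?_
  refine tendsto_nhdsWithin_iff.2 ⟨?_, ?_⟩
  · have h2 : ContinuousAt (fun z : ℝ => -z / (1 - z)) (1 / 2) :=
      continuousAt_id.neg.div (continuousAt_const.sub continuousAt_id) (by norm_num)
    have h := h2.tendsto.mono_left (nhdsWithin_le_nhds (s := Iio (1 / 2)))
    norm_num at h ⊢
    exact h
  · filter_upwards [Ioo_mem_nhdsLT (by norm_num : (0 : ℝ) < 1 / 2)] with s hs
    have := abs_lt.1 (landen_abs_lt_one hs)
    exact ⟨this.1.le, this.2.le⟩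

theorem tendsto_nhdsLT_half {g : ℝ → ℝ} (hg : ContinuousOn g (Icc (-1) 1)) :
    Tendsto g (𝓝[<] (1 / 2)) (𝓝 (g (1 / 2))) :=
  (hg.continuousAt (Icc_mem_nhds (by norm_num) (by norm_num))).tendsto.mono_left nhdsWithin_le_nhds

theorem tendsto_log_one_sub_half :
    Tendsto (fun z : ℝ => Real.log (1 - z)) (𝓝[<] (1 / 2)) (𝓝 (-Real.log 2)) := by
  have h := (hasDerivAt_log_one_sub (by norm_num : (1 / 2 : ℝ) < 1)).continuousAt.tendsto.mono_left
    (nhdsWithin_le_nhds (s := Iio (1 / 2)))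
  rwa [show (1 - 1 / 2 : ℝ) = 2⁻¹ by norm_num, Real.log_inv] at h

theorem liSeries_two_landen {z : ℝ} (hz : z ∈ Ioo (0 : ℝ) (1 / 2)) :
    liSeries 2 (-z / (1 - z)) + liSeries 2 z + Real.log (1 - z) ^ 2 / 2 = 0 := by
  refine eq_of_hasDerivAt_zero (f := fun z => liSeries 2 (-z / (1 - z)) + liSeries 2 z +
    Real.log (1 - z) ^ 2 / 2) (fun t ht => ?_) ?_ hz
  · have h1 : 1 - t ≠ 0 := by linarith [ht.2]
    have h2 : t ≠ 0 := ht.1.ne'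
    have ht' := mem_unit_of_mem_half ht
    refine (((hasDerivAt_liSeries_landen ht 0).add (hasDerivAt_liSeries_two ht')).add
      (((hasDerivAt_log_one_sub ht'.2).pow 2).div_const 2)).congr_deriv ?_
    rw [liSeries_one (landen_abs_lt_one ht), log_one_sub_landen ht]
    field_simp
    ring
  · have h := ((tendsto_landen_zero (continuousOn_liSeries le_rfl)).add
      (tendsto_nhdsGT_zero (continuousOn_liSeries le_rfl))).add
      ((tendsto_log_one_sub.pow 2).div_const 2)
    simpa [liSeries_zero] using h

theorem nielsen_two_landen {z : ℝ} (hz : z ∈ Ioo (0 : ℝ) (1 / 2)) :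
    nielsen 2 (-z / (1 - z)) - nielsen 2 z + Real.log (1 - z) ^ 3 / 6 = 0 := by
  refine eq_of_hasDerivAt_zero (f := fun z => nielsen 2 (-z / (1 - z)) - nielsen 2 z +
    Real.log (1 - z) ^ 3 / 6) (fun t ht => ?_) ?_ hz
  · have h1 : 1 - t ≠ 0 := by linarith [ht.2]
    have h2 : t ≠ 0 := ht.1.ne'
    have ht' := mem_unit_of_mem_half ht
    refine (((hasDerivAt_nielsen_landen ht 0).sub (hasDerivAt_nielsen_two ht')).add
      (((hasDerivAt_log_one_sub ht'.2).pow 3).div_const 6)).congr_deriv ?_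
    rw [nielsen_one (landen_abs_lt_one ht), log_one_sub_landen ht]
    field_simp
    ring
  · have h := ((tendsto_landen_zero (continuousOn_nielsen le_rfl)).sub
      (tendsto_nhdsGT_zero (continuousOn_nielsen le_rfl))).add
      ((tendsto_log_one_sub.pow 3).div_const 6)
    simpa [nielsen_zero] using h

/-- The Landen map sends 1/2 to -1, on the boundary of the disc of convergence, so the identity is
reached as a left limit at 1/2. Since Li_3(-1) is a multiple of ζ(3), it determines Li_3(1/2). -/
theorem liSeries_three_neg_one :
    liSeries 3 (-1) + liSeries 3 (1 / 2) - nielsen 2 (1 / 2)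
      - -Real.log 2 * liSeries 2 (1 / 2) - (-Real.log 2) ^ 3 / 6 = 0 := by
  symm
  refine limits_eq_of_hasDerivAt_zero (f := fun z => liSeries 3 (-z / (1 - z)) + liSeries 3 z
    - nielsen 2 z - Real.log (1 - z) * liSeries 2 z - Real.log (1 - z) ^ 3 / 6)
    (by norm_num : (0 : ℝ) < 1 / 2) (fun t ht => ?_) ?_ ?_
  · have h1 : 1 - t ≠ 0 := by linarith [ht.2]
    have h2 : t ≠ 0 := ht.1.ne'
    have ht' := mem_unit_of_mem_half ht
    refine (((((hasDerivAt_liSeries_landen ht 1).add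
      (hasDerivAt_liSeries 1 (abs_lt_one_of_mem ht') h2)).sub
      (hasDerivAt_nielsen_two ht')).sub
      ((hasDerivAt_log_one_sub ht'.2).mul (hasDerivAt_liSeries_two ht'))).sub
      (((hasDerivAt_log_one_sub ht'.2).pow 3).div_const 6)).congr_deriv ?_
    have h3 : liSeries 2 (-t / (1 - t)) = -liSeries 2 t - Real.log (1 - t) ^ 2 / 2 := by
      linear_combination liSeries_two_landen ht
    rw [h3]
    field_simp
    ring
  · have h := ((((tendsto_landen_zero (continuousOn_liSeries (k := 3) (by norm_num))).add
      (tendsto_nhdsGT_zero (continuousOn_liSeries (k := 3) (by norm_num)))).sub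
      (tendsto_nhdsGT_zero (continuousOn_nielsen le_rfl))).sub
      (tendsto_log_one_sub.mul (tendsto_nhdsGT_zero (continuousOn_liSeries le_rfl)))).sub
      ((tendsto_log_one_sub.pow 3).div_const 6)
    simpa [liSeries_zero, nielsen_zero] using h
  · exact ((((tendsto_landen_half (continuousOn_liSeries (k := 3) (by norm_num))).add
      (tendsto_nhdsLT_half (continuousOn_liSeries (k := 3) (by norm_num)))).sub
      (tendsto_nhdsLT_half (continuousOn_nielsen le_rfl))).sub
      (tendsto_log_one_sub_half.mul (tendsto_nhdsLT_half (continuousOn_liSeries le_rfl)))).sub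
      ((tendsto_log_one_sub_half.pow 3).div_const 6)

/-- The Nielsen polylogarithm `S_{1,3}`, through its reflection formula. -/
def nielsenOneThree (z : ℝ) : ℝ :=
  liSeries 4 1 - (liSeries 4 (1 - z) - Real.log (1 - z) * liSeries 3 (1 - z)
    + Real.log (1 - z) ^ 2 * liSeries 2 (1 - z) / 2
    + Real.log z * Real.log (1 - z) * Real.log (1 - z) ^ 2 / 6)

/-- This derivative and the limit 0 at 0 are what identify the function as S_{1,3}. Taking the
reflection formula as definition makes the value at 1/2 explicit, with Li_4(1/2) in it. -/
theorem hasDerivAt_nielsenOneThree {z : ℝ} (hz : z ∈ Ioo (0 : ℝ) 1) :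
    HasDerivAt nielsenOneThree (-(Real.log (1 - z) ^ 3 / 6 / z)) z := by
  have h1 : 1 - z ≠ 0 := by linarith [hz.2]
  have h2 : z ≠ 0 := hz.1.ne'
  have hu := hasDerivAt_log_one_sub hz.2
  refine (((((hasDerivAt_liSeries_one_sub hz 2).sub
    (hu.mul (hasDerivAt_liSeries_one_sub hz 1))).add
    (((hu.pow 2).mul (hasDerivAt_liSeries_two_one_sub hz)).div_const 2)).add
    ((((Real.hasDerivAt_log h2).mul hu).mul (hu.pow 2)).div_const 6)).const_sub _).congr_deriv ?_
  simp only [Pi.mul_apply, Pi.pow_apply]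
  field_simp
  ring

theorem tendsto_nielsenOneThree_zero : Tendsto nielsenOneThree (𝓝[>] 0) (𝓝 0) := by
  have h := ((((tendsto_one_sub_nhdsGT_zero (continuousOn_liSeries (k := 4) (by norm_num))).sub
    (tendsto_log_one_sub.mul (tendsto_one_sub_nhdsGT_zero
      (continuousOn_liSeries (k := 3) (by norm_num))))).add
    (((tendsto_log_one_sub.pow 2).mul (tendsto_one_sub_nhdsGT_zero
      (continuousOn_liSeries le_rfl))).div_const 2)).add
    ((tendsto_log_mul_log_one_sub.mul (tendsto_log_one_sub.pow 2)).div_const 6)).const_sub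
    (liSeries 4 1)
  have h0 : Tendsto nielsenOneThree (𝓝[>] 0) _ := h
  simpa using h0

/-- The weight-four analogue: integrating `nielsen_two_landen` against 1/t + 1/(1-t) brings in
log³(1-t)/t, hence S_{1,3}. -/
theorem nielsen_three_neg_one :
    nielsen 3 (-1) - nielsen 3 (1 / 2) + -Real.log 2 * nielsen 2 (1 / 2)
      + 2 * nielsenOneThree (1 / 2) - (-Real.log 2) ^ 4 / 24 = 0 := by
  symm
  refine limits_eq_of_hasDerivAt_zero (f := fun z => nielsen 3 (-z / (1 - z)) - nielsen 3 z
    + Real.log (1 - z) * nielsen 2 z + 2 * nielsenOneThree z - Real.log (1 - z) ^ 4 / 24)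
    (by norm_num : (0 : ℝ) < 1 / 2) (fun t ht => ?_) ?_ ?_
  · have h1 : 1 - t ≠ 0 := by linarith [ht.2]
    have h2 : t ≠ 0 := ht.1.ne'
    have ht' := mem_unit_of_mem_half ht
    refine (((((hasDerivAt_nielsen_landen ht 1).sub
      (hasDerivAt_nielsen 1 (abs_lt_one_of_mem ht') h2)).add
      ((hasDerivAt_log_one_sub ht'.2).mul (hasDerivAt_nielsen_two ht'))).add
      ((hasDerivAt_nielsenOneThree ht').const_mul 2)).sub
      (((hasDerivAt_log_one_sub ht'.2).pow 4).div_const 24)).congr_deriv ?_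
    have h3 : nielsen 2 (-t / (1 - t)) = nielsen 2 t - Real.log (1 - t) ^ 3 / 6 := by
      linear_combination nielsen_two_landen ht
    rw [h3]
    field_simp
    ring
  · have h := ((((tendsto_landen_zero (continuousOn_nielsen (k := 3) (by norm_num))).sub
      (tendsto_nhdsGT_zero (continuousOn_nielsen (k := 3) (by norm_num)))).add
      (tendsto_log_one_sub.mul (tendsto_nhdsGT_zero (continuousOn_nielsen le_rfl)))).add
      (tendsto_nielsenOneThree_zero.const_mul 2)).sub
      ((tendsto_log_one_sub.pow 4).div_const 24)
    simpa [nielsen_zero] using h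
  · exact ((((tendsto_landen_half (continuousOn_nielsen (k := 3) (by norm_num))).sub
      (tendsto_nhdsLT_half (continuousOn_nielsen (k := 3) (by norm_num)))).add
      (tendsto_log_one_sub_half.mul (tendsto_nhdsLT_half (continuousOn_nielsen le_rfl)))).add
      (((hasDerivAt_nielsenOneThree (by norm_num)).continuousAt.tendsto.mono_left
        nhdsWithin_le_nhds).const_mul 2)).sub
      ((tendsto_log_one_sub_half.pow 4).div_const 24)

/-! ### Euler's double zeta value and the alternating sum of weight four -/

theorem harmonicPred_succ (n : ℕ) :
    harmonicPred (n + 1) = ∑ i ∈ Finset.range n, 1 / ((i : ℝ) + 1) := by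
  rw [harmonicPred, Finset.sum_range_succ']
  simp

theorem hasSum_of_eq {ι : Type*} {f g : ι → ℝ} {a : ℝ} (h : HasSum f a) (e : ∀ i, g i = f i) :
    HasSum g a := by
  rwa [funext e]

theorem hasSum_antidiagonal {F : ℕ × ℕ → ℝ} (hF : Summable F) :
    HasSum (fun N => ∑ p ∈ Finset.HasAntidiagonal.antidiagonal N, F p) (∑' p, F p) := by
  have h := (Finset.HasAntidiagonal.sigmaAntidiagonalEquivProd.hasSum_iff (f := F)).2 hF.hasSum
  exact h.sigma fun N => by
    rw [← Finset.sum_coe_sort]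
    exact hasSum_fintype (fun p : Finset.HasAntidiagonal.antidiagonal N => F p)

theorem sq_tsum_eq {c : ℕ → ℝ} {S T U : ℝ} (hc : HasSum c S)
    (h2 : HasSum (fun n => c n ^ 2) T) (h3 : HasSum (fun n => (∑ i ∈ Finset.range n, c i) * c n) U) :
    S ^ 2 = 2 * U + T := by
  have hfin : ∀ N, (∑ n ∈ Finset.range N, c n) ^ 2
      = 2 * ∑ n ∈ Finset.range N, (∑ i ∈ Finset.range n, c i) * c n
        + ∑ n ∈ Finset.range N, c n ^ 2 := by
    intro N
    induction N with
    | zero => simp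
    | succ N ih => simp only [Finset.sum_range_succ] at ih ⊢; linear_combination ih
  refine tendsto_nhds_unique (hc.tendsto_sum_nat.pow 2) ?_
  simp only [hfin]
  exact (h3.tendsto_sum_nat.const_mul 2).add h2.tendsto_sum_nat

/-- Euler's evaluation of the double zeta value `ζ(3, 1)`, from `ζ(2) ^ 2`. -/
theorem nielsen_three_one : nielsen 3 1 = liSeries 4 1 / 4 := by
  set c : ℕ → ℝ := fun n => 1 / ((n : ℝ) + 1) ^ 2 with hcdef
  have hli : ∀ k, 2 ≤ k → HasSum (fun n : ℕ => 1 / ((n : ℝ) + 1) ^ k) (liSeries k 1) := by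
    intro k hk
    have h : HasSum (fun n : ℕ => 1 / (n : ℝ) ^ k) (liSeries k 1) := by
      have := (Real.summable_one_div_nat_pow.2 hk).hasSum
      simpa [liSeries, powerSum] using this
    rw [← hasSum_nat_add_iff' 1] at h
    simpa [show k ≠ 0 by omega] using h
  have hc := hli 2 le_rfl
  have hcn : Summable fun n => ‖c n‖ := hc.summable.norm
  have hF : Summable fun p : ℕ × ℕ => c p.1 * c p.2 := summable_mul_of_summable_norm hcn hcn
  have hFs : ∑' p : ℕ × ℕ, c p.1 * c p.2 = liSeries 2 1 ^ 2 := by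
    rw [← tsum_mul_tsum_of_summable_norm hcn hcn, hc.tsum_eq, sq]
  set A : ℕ × ℕ → ℝ := fun p => 1 / (((p.1 : ℝ) + 1) ^ 2 * ((p.1 : ℝ) + p.2 + 2) ^ 2) with hA
  set B : ℕ × ℕ → ℝ := fun p => 1 / (((p.1 : ℝ) + 1) * ((p.1 : ℝ) + p.2 + 2) ^ 3) with hB
  -- With a = m+1, b = n+1, s = a+b: 1/(a²b²) = (1/a² + 1/b²)/s² + 2(1/a + 1/b)/s³. Summed, this
  -- reads ζ(2)² = 2ζ(2,2) + 4ζ(3,1).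
  have hpf : ∀ p : ℕ × ℕ, c p.1 * c p.2 = A p + A p.swap + (2 * B p + 2 * B p.swap) := by
    rintro ⟨m, n⟩
    simp only [hcdef, hA, hB, Prod.swap]
    have h1 : (m : ℝ) + 1 ≠ 0 := by positivity
    have h2 : (n : ℝ) + 1 ≠ 0 := by positivity
    have h3 : (m : ℝ) + n + 2 ≠ 0 := by positivity
    have h4 : (n : ℝ) + m + 2 = m + n + 2 := by ring
    rw [h4]
    field_simp
    ring
  have hA0 : ∀ p, 0 ≤ A p := fun p => by simp only [hA]; positivity
  have hB0 : ∀ p, 0 ≤ B p := fun p => by simp only [hB]; positivity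
  have hAs : Summable A := Summable.of_nonneg_of_le hA0 (fun p => by
    rw [hpf p]; linarith [hA0 p.swap, hB0 p, hB0 p.swap]) hF
  have hBs : Summable B := Summable.of_nonneg_of_le hB0 (fun p => by
    rw [hpf p]; linarith [hA0 p.swap, hB0 p, hA0 p, hB0 p.swap]) hF
  have hA' : HasSum (fun p : ℕ × ℕ => A p.swap) (∑' p, A p) :=
    (Equiv.prodComm ℕ ℕ).hasSum_iff.2 hAs.hasSum
  have hB' : HasSum (fun p : ℕ × ℕ => B p.swap) (∑' p, B p) :=
    (Equiv.prodComm ℕ ℕ).hasSum_iff.2 hBs.hasSum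
  have e1 : liSeries 2 1 ^ 2 = ∑' p, A p + ∑' p, A p + (2 * ∑' p, B p + 2 * ∑' p, B p) := by
    rw [← hFs]
    have := (hAs.hasSum.add hA').add ((hBs.hasSum.mul_left 2).add (hB'.mul_left 2))
    rw [← this.tsum_eq]
    exact tsum_congr hpf
  have eA : HasSum (fun n => (∑ i ∈ Finset.range n, c i) * c n) (∑' p, A p) := by
    rw [← hasSum_nat_add_iff' 1]
    simp only [Finset.sum_range_one, Finset.range_zero, Finset.sum_empty, zero_mul, sub_zero]
    have h := hasSum_antidiagonal hAs
    refine hasSum_of_eq h fun N => ?_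
    rw [Finset.Nat.sum_antidiagonal_eq_sum_range_succ_mk, Finset.sum_mul]
    refine Finset.sum_congr rfl fun i hi => ?_
    have hi' : i ≤ N := Nat.lt_succ_iff.1 (Finset.mem_range.1 hi)
    simp only [hcdef, hA]
    rw [Nat.cast_sub hi', one_div_mul_one_div]
    push_cast
    ring_nf
  have eB : nielsen 3 1 = ∑' p, B p := by
    have h := hasSum_antidiagonal hBs
    have h2 : HasSum (fun n : ℕ => harmonicPred n / (n : ℝ) ^ 3) (∑' p, B p) := by
      -- The terms n = 0 and n = 1 vanish: an empty sum, and the single summand `1 / 0 = 0`.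
      have e0 : ∑ n ∈ Finset.range 2, harmonicPred n / (n : ℝ) ^ 3 = 0 := by
        simp [Finset.sum_range_succ, harmonicPred]
      rw [← hasSum_nat_add_iff' 2, e0, sub_zero]
      refine hasSum_of_eq h fun N => ?_
      change harmonicPred (N + 1 + 1) / _ = _
      rw [harmonicPred_succ]
      rw [Finset.Nat.sum_antidiagonal_eq_sum_range_succ_mk, Finset.sum_div]
      refine Finset.sum_congr rfl fun i hi => ?_
      have hi' : i ≤ N := Nat.lt_succ_iff.1 (Finset.mem_range.1 hi)
      simp only [hB]
      rw [Nat.cast_sub hi', div_div]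
      push_cast
      ring_nf
    simpa [nielsen, powerSum] using h2.tsum_eq
  -- Splitting the square along the diagonal gives ζ(2)² = 2ζ(2,2) + ζ(4); comparison with `e1`
  -- leaves 4ζ(3,1) = ζ(4).
  have e2 := sq_tsum_eq hc (by simpa [hcdef, ← pow_mul] using hli 4 (by norm_num)) eA
  rw [eB]
  linarith

/-- The value of `∑ (-1) ^ n * H_{n-1} / n ^ 3`. -/
theorem nielsen_three_neg_one_eq :
    nielsen 3 (-1) = -15 / 8 * liSeries 4 1 + 2 * liSeries 4 (1 / 2)
      + 7 / 4 * Real.log 2 * liSeries 3 1 - liSeries 2 1 / 2 * Real.log 2 ^ 2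
      + Real.log 2 ^ 4 / 12 := by
  have hz : (1 / 2 : ℝ) ∈ Ioo (0 : ℝ) 1 := by norm_num
  have hl : Real.log (1 / 2) = -Real.log 2 := by rw [one_div, Real.log_inv]
  have a1 := liSeries_two_reflection hz
  have a2 := nielsen_two_eq hz
  have a3 := nielsen_three_reflection hz
  have a4 := liSeries_three_neg_one
  have a5 := nielsen_three_neg_one
  have a6 := liSeries_neg_one (k := 3) (by norm_num)
  have a7 := nielsen_three_one
  -- At the fixed point 1/2 every relation is linear in the unknown values there. Li_2, Li_3,
  -- `nielsen 2` and `nielsen 3` at 1/2 are all eliminated, so only Li_4(1/2) survives.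
  rw [nielsenOneThree] at a5
  rw [show (1 - 1 / 2 : ℝ) = 1 / 2 by norm_num, hl] at a1 a2 a3 a5
  set l := Real.log 2
  rw [a6] at a4
  have b2 : liSeries 2 (1 / 2) = (liSeries 2 1 - l ^ 2) / 2 := by linear_combination a1 / 2
  have b3 : nielsen 2 (1 / 2) = liSeries 3 1 - liSeries 3 (1 / 2) - l * liSeries 2 (1 / 2)
      - l ^ 3 / 2 := by linear_combination a2
  rw [b3, b2] at a4
  have b4 : liSeries 3 (1 / 2) = 7 / 8 * liSeries 3 1 - l * liSeries 2 1 / 2 + l ^ 3 / 6 := by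
    linear_combination a4 / 2
  have b5 : nielsen 2 (1 / 2) = liSeries 3 1 / 8 - l ^ 3 / 6 := by rw [b3, b2, b4]; ring
  have b6 : nielsen 3 (1 / 2) = liSeries 4 1 / 8 - l * nielsen 2 (1 / 2) - l ^ 4 / 8 := by
    linear_combination a3 / 2 + a7 / 2
  rw [b6, b5, b4, b2] at a5
  linear_combination a5

/-! ### Odd harmonic series and the Cayley transform -/

/-- The series `∑ h_n z ^ n / n ^ k` with the odd harmonic numbers `h_n`. -/
def oddSeries (𝕜 : Type*) [RCLike 𝕜] (k : ℕ) : 𝕜 → 𝕜 :=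
  powerSum fun n : ℕ => ((oddHarmonic n / (n : ℝ) ^ k : ℝ) : 𝕜)

theorem one_div_odd_le_one (i : ℕ) : 1 / (2 * (i : ℝ) + 1) ≤ 1 := by
  rw [div_le_one (by positivity)]
  linarith [(i.cast_nonneg : (0 : ℝ) ≤ i)]

theorem one_div_odd_le (i : ℕ) : 1 / (2 * (i : ℝ) + 1) ≤ 2 / ((i : ℝ) + 1) := by
  rw [div_le_div_iff₀ (by positivity) (by positivity)]
  linarith [(i.cast_nonneg : (0 : ℝ) ≤ i)]

theorem oddHarmonic_nonneg (n : ℕ) : 0 ≤ oddHarmonic n :=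
  Finset.sum_nonneg fun i _ => by positivity

theorem oddHarmonic_le (n : ℕ) : oddHarmonic n ≤ n :=
  (Finset.sum_le_sum fun i _ => one_div_odd_le_one i).trans (by simp)

theorem summable_oddHarmonic_div {k : ℕ} (hk : 2 ≤ k) :
    Summable fun n : ℕ => oddHarmonic n / (n : ℝ) ^ k :=
  summable_partialSum_div (fun i => by positivity) one_div_odd_le hk

theorem oddHarmonic_div_le {k : ℕ} (hk : 1 ≤ k) (n : ℕ) :
    |oddHarmonic n / (n : ℝ) ^ k| ≤ 1 := by
  rw [abs_of_nonneg (div_nonneg (oddHarmonic_nonneg n) (by positivity))]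
  rcases n.eq_zero_or_pos with rfl | hn
  · simp [oddHarmonic]
  have h1 : (1 : ℝ) ≤ n := by exact_mod_cast hn
  rw [div_le_one (by positivity)]
  exact (oddHarmonic_le n).trans (le_self_pow₀ h1 (by omega))

section Complex

theorem mul_powerSum_succ {a : ℕ → ℂ} (ha : ∀ n, ‖a n‖ ≤ 1) {z : ℂ} (hz : ‖z‖ < 1) :
    z * powerSum (fun n => (n + 1) * a (n + 1)) z = powerSum (fun n => n * a n) z := by
  rcases eq_or_ne z 0 with rfl | h0
  · simp [powerSum_zero]
  have h := (hasDerivAt_powerSum ha hz).unique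
    (hasDerivAt_powerSum_div (b := fun n => n * a n) ha (fun n => rfl) hz h0)
  rw [h]
  field_simp

theorem norm_oddHarmonic_div_le {k : ℕ} (hk : 1 ≤ k) (n : ℕ) :
    ‖((oddHarmonic n / (n : ℝ) ^ k : ℝ) : ℂ)‖ ≤ 1 := by
  rw [Complex.norm_real]; exact oddHarmonic_div_le hk n

theorem cayley_re_pos {z : ℂ} (hz : ‖z‖ < 1) : 0 < ((1 - z) / (1 + z)).re := by
  have h0 : 1 + z ≠ 0 := by
    intro h
    have : z = -1 := by linear_combination h
    simp [this] at hz
  have h1 : z.re * z.re + z.im * z.im < 1 := by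
    rw [← Complex.normSq_apply, Complex.normSq_eq_norm_sq]
    nlinarith [norm_nonneg z]
  rw [Complex.div_re, ← add_div]
  apply div_pos _ (Complex.normSq_pos.2 h0)
  simp
  nlinarith

theorem cayley_norm_lt {z : ℂ} (hz : 0 < z.re) : ‖(1 - z) / (1 + z)‖ < 1 := by
  have h0 : 1 + z ≠ 0 := by
    intro h
    have := congrArg Complex.re h
    simp at this
    linarith
  rw [norm_div, div_lt_one (norm_pos_iff.2 h0), ← sq_lt_sq₀ (norm_nonneg _) (norm_nonneg _),
    ← Complex.normSq_eq_norm_sq, ← Complex.normSq_eq_norm_sq, Complex.normSq_apply,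
    Complex.normSq_apply]
  simp
  nlinarith

theorem one_add_ne_zero_of_norm {z : ℂ} (hz : ‖z‖ < 1) : 1 + z ≠ 0 := by
  intro h
  have : z = -1 := by linear_combination h
  simp [this] at hz

theorem one_sub_ne_zero_of_norm {z : ℂ} (hz : ‖z‖ < 1) : 1 - z ≠ 0 := by
  intro h
  have : z = 1 := by linear_combination -h
  simp [this] at hz

theorem hasDerivAt_cayley {z : ℂ} (hz : 1 + z ≠ 0) :
    HasDerivAt (fun z : ℂ => (1 - z) / (1 + z)) (-2 / (1 + z) ^ 2) z := by
  refine (((hasDerivAt_id z).const_sub 1).div ((hasDerivAt_id z).const_add 1) hz).congr_deriv ?_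
  simp only [id]
  congr 1
  ring

theorem hasDerivAt_log_cayley {z : ℂ} (hz : ‖z‖ < 1) :
    HasDerivAt (fun z : ℂ => Complex.log ((1 - z) / (1 + z))) (-2 / (1 - z ^ 2)) z := by
  have h1 := one_add_ne_zero_of_norm hz
  have h2 := one_sub_ne_zero_of_norm hz
  refine ((hasDerivAt_cayley h1).clog (Or.inl (cayley_re_pos hz))).congr_deriv ?_
  have h3 : 1 - z ^ 2 = (1 - z) * (1 + z) := by ring
  rw [h3]
  field_simp

theorem norm_sq_lt_one {z : ℂ} (hz : ‖z‖ < 1) : ‖z ^ 2‖ < 1 := by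
  rw [norm_pow]; exact pow_lt_one₀ (norm_nonneg _) hz two_ne_zero

theorem hasDerivAt_powerSum_sq {a : ℕ → ℂ} (ha : ∀ n, ‖a n‖ ≤ 1) {z : ℂ} (hz : ‖z‖ < 1) :
    HasDerivAt (fun z => powerSum a (z ^ 2))
      (powerSum (fun n => (n + 1) * a (n + 1)) (z ^ 2) * (2 * z)) z := by
  have h := (hasDerivAt_powerSum ha (norm_sq_lt_one hz)).comp z (hasDerivAt_pow 2 z)
  exact h.congr_deriv (by norm_num)

theorem norm_one_div_odd_le (n : ℕ) : ‖((1 / (2 * (n : ℝ) + 1) : ℝ) : ℂ)‖ ≤ 1 := by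
  rw [Complex.norm_real, Real.norm_of_nonneg (by positivity)]
  exact one_div_odd_le_one n

/-- Both sides vanish at 0 and have derivative -2/(1-z²), a geometric series since (2n+1) · 1/(2n+1)
= 1. -/
theorem log_cayley_eq {z : ℂ} (hz : ‖z‖ < 1) :
    Complex.log ((1 - z) / (1 + z))
      = -2 * (z * powerSum (fun n : ℕ => ((1 / (2 * (n : ℝ) + 1) : ℝ) : ℂ)) (z ^ 2)) := by
  set c := fun n : ℕ => ((1 / (2 * (n : ℝ) + 1) : ℝ) : ℂ) with hc
  have hd : ∀ y ∈ Metric.ball (0 : ℂ) 1,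
      HasDerivAt (fun z => -2 * (z * powerSum c (z ^ 2))) (-2 / (1 - y ^ 2)) y := by
    intro y hy
    have hy' : ‖y‖ < 1 := by simpa using hy
    have hy2 := norm_sq_lt_one hy'
    refine (((hasDerivAt_id y).mul
      (hasDerivAt_powerSum_sq norm_one_div_odd_le hy')).const_mul (-2)).congr_deriv ?_
    have h1 := mul_powerSum_succ norm_one_div_odd_le hy2
    have hs0 : Summable fun n => c n * (y ^ 2) ^ n :=
      summable_powerSum (C := 1) (fun n => (norm_one_div_odd_le n).trans (by
        have : (0 : ℝ) ≤ n := n.cast_nonneg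
        linarith)) hy2
    have hs1 : Summable fun n : ℕ => (n : ℂ) * c n * (y ^ 2) ^ n :=
      summable_powerSum (C := 1) (fun n => by
        rw [norm_mul, Complex.norm_natCast]
        have : (0 : ℝ) ≤ n := n.cast_nonneg
        nlinarith [norm_one_div_odd_le n]) hy2
    have h2 : powerSum c (y ^ 2) + 2 * powerSum (fun n => n * c n) (y ^ 2) = (1 - y ^ 2)⁻¹ := by
      rw [← tsum_geometric_of_norm_lt_one hy2, powerSum, powerSum, ← tsum_mul_left,
        ← hs0.tsum_add (hs1.mul_left 2)]
      refine tsum_congr fun n => ?_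
      have h3 : (2 * (n : ℂ) + 1) ≠ 0 := by exact_mod_cast (by positivity : (2 * (n : ℝ) + 1) ≠ 0)
      simp only [hc]
      push_cast
      field_simp
      ring
    rw [div_eq_mul_inv, ← h2, ← h1]
    simp only [id]
    ring
  refine (Metric.isOpen_ball.eqOn_of_deriv_eq (convex_ball (0 : ℂ) 1).isPreconnected
    (fun y hy => (hasDerivAt_log_cayley (by simpa using hy)).differentiableAt.differentiableWithinAt)
    (fun y hy => (hd y hy).differentiableAt.differentiableWithinAt)
    (fun y hy => (hasDerivAt_log_cayley (by simpa using hy)).deriv.trans (hd y hy).deriv.symm)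
    (Metric.mem_ball_self one_pos) ?_ (mem_ball_zero_iff.2 hz))
  simp

/-- Differentiation removes the 1/n and leaves the generating function of the partial sums h_{n+1},
which is the series of `log_cayley_eq` divided by 1 - z². The result is half the logarithm times its
own derivative. -/
theorem oddSeries_one_sq {z : ℂ} (hz : ‖z‖ < 1) :
    oddSeries ℂ 1 (z ^ 2) = Complex.log ((1 - z) / (1 + z)) ^ 2 / 4 := by
  have hd : ∀ y ∈ Metric.ball (0 : ℂ) 1, HasDerivAt (fun z => oddSeries ℂ 1 (z ^ 2))
      (-(Complex.log ((1 - y) / (1 + y)) / (1 - y ^ 2))) y := by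
    intro y hy
    have hy' : ‖y‖ < 1 := by simpa using hy
    have hy2 := norm_sq_lt_one hy'
    refine (hasDerivAt_powerSum_sq (norm_oddHarmonic_div_le le_rfl) hy').congr_deriv ?_
    have h1 : 1 - y ^ 2 ≠ 0 := one_sub_ne_zero_of_norm hy2
    have h2 := powerSum_partialSum norm_one_div_odd_le hy2
    rw [log_cayley_eq hy', ← h2]
    have h3 : (fun n : ℕ => ((n : ℂ) + 1) * ((oddHarmonic (n + 1) / ((n + 1 : ℕ) : ℝ) ^ 1 : ℝ) : ℂ))
        = fun n => ∑ i ∈ Finset.range (n + 1), ((1 / (2 * (i : ℝ) + 1) : ℝ) : ℂ) := by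
      funext n
      have h4 : (n : ℂ) + 1 ≠ 0 := by exact_mod_cast n.succ_ne_zero
      rw [← Complex.ofReal_sum, ← oddHarmonic]
      push_cast
      field_simp
    rw [h3]
    field_simp
  have hd2 : ∀ y ∈ Metric.ball (0 : ℂ) 1,
      HasDerivAt (fun z : ℂ => Complex.log ((1 - z) / (1 + z)) ^ 2 / 4)
      (-(Complex.log ((1 - y) / (1 + y)) / (1 - y ^ 2))) y := by
    intro y hy
    have hy' : ‖y‖ < 1 := by simpa using hy
    refine (((hasDerivAt_log_cayley hy').pow 2).div_const 4).congr_deriv ?_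
    ring
  refine (Metric.isOpen_ball.eqOn_of_deriv_eq (convex_ball (0 : ℂ) 1).isPreconnected
    (fun y hy => (hd y hy).differentiableAt.differentiableWithinAt)
    (fun y hy => (hd2 y hy).differentiableAt.differentiableWithinAt)
    (fun y hy => (hd y hy).deriv.trans (hd2 y hy).deriv.symm)
    (Metric.mem_ball_self one_pos) ?_ (mem_ball_zero_iff.2 hz))
  simp [oddSeries, powerSum_zero, oddHarmonic]

theorem hasDerivAt_oddSeries_sq (k : ℕ) {z : ℂ} (hz : ‖z‖ < 1) (h0 : z ≠ 0) :
    HasDerivAt (fun z => oddSeries ℂ (k + 2) (z ^ 2)) (2 * oddSeries ℂ (k + 1) (z ^ 2) / z) z := by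
  have h := (hasDerivAt_powerSum_div (a := fun n : ℕ => ((oddHarmonic n / (n : ℝ) ^ (k + 2) : ℝ) : ℂ))
    (b := fun n : ℕ => ((oddHarmonic n / (n : ℝ) ^ (k + 1) : ℝ) : ℂ))
    (norm_oddHarmonic_div_le (by omega)) (fun n => ?_) (norm_sq_lt_one hz) (pow_ne_zero 2 h0)).comp z
    (hasDerivAt_pow 2 z)
  · refine HasDerivAt.congr_deriv h ?_
    simp only [oddSeries]
    field_simp
    norm_num
    ring
  · rcases n.eq_zero_or_pos with rfl | hn
    · simp [oddHarmonic]
    have h1 : (n : ℂ) ≠ 0 := by exact_mod_cast hn.ne'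
    push_cast
    field_simp
    ring

theorem hasDerivAt_oddSeries_cayley (k : ℕ) {z : ℂ} (hz : ‖z‖ < 1) (h0 : 0 < z.re) :
    HasDerivAt (fun z => oddSeries ℂ (k + 2) (((1 - z) / (1 + z)) ^ 2))
      (2 * oddSeries ℂ (k + 1) (((1 - z) / (1 + z)) ^ 2) * (-2 / (1 - z ^ 2))) z := by
  have h1 := one_add_ne_zero_of_norm hz
  have h2 := one_sub_ne_zero_of_norm hz
  have h := (hasDerivAt_oddSeries_sq k (cayley_norm_lt h0) (div_ne_zero h2 h1)).comp z
    (hasDerivAt_cayley h1)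
  refine HasDerivAt.congr_deriv h ?_
  have h3 : 1 - z ^ 2 = (1 - z) * (1 + z) := by ring
  rw [h3]
  field_simp

theorem cayley_cayley {z : ℂ} (hz : 1 + z ≠ 0) :
    (1 - (1 - z) / (1 + z)) / (1 + (1 - z) / (1 + z)) = z := by
  have h : (1 + (1 - z) / (1 + z)) = 2 / (1 + z) := by field_simp; ring
  rw [h]
  field_simp
  ring

/-- The combination of polylogarithms of `z ^ 2` and of the square of the Cayley transform of `z`
that is constant on the right half of the unit disc. -/
def cayleyInvariant (z : ℂ) : ℂ :=
  oddSeries ℂ 3 (z ^ 2) - 2 * (oddSeries ℂ 2 (z ^ 2) * Complex.log z)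
    + oddSeries ℂ 3 (((1 - z) / (1 + z)) ^ 2)
    - 2 * (oddSeries ℂ 2 (((1 - z) / (1 + z)) ^ 2) * Complex.log ((1 - z) / (1 + z)))
    + (Complex.log z * Complex.log ((1 - z) / (1 + z))) ^ 2 / 2

/-- The weight-two terms cancel by the product rule. The remaining weight-one series at z² and w²
are log² w / 4 and log² z / 4, because the Cayley transform of w is z again, and they cancel the
derivative of the last term. The condition 0 < Re z gives |w| < 1 and keeps z off the branch cut. -/
theorem hasDerivAt_cayleyInvariant {z : ℂ} (hz : ‖z‖ < 1) (h0 : 0 < z.re) :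
    HasDerivAt cayleyInvariant 0 z := by
  have hz0 : z ≠ 0 := by rintro rfl; simp at h0
  have h1 := one_add_ne_zero_of_norm hz
  have hL := Complex.hasDerivAt_log (Or.inl h0 : z ∈ Complex.slitPlane)
  have hM := hasDerivAt_log_cayley hz
  refine (((((hasDerivAt_oddSeries_sq 1 hz hz0).sub
    (((hasDerivAt_oddSeries_sq 0 hz hz0).mul hL).const_mul 2)).add
    (hasDerivAt_oddSeries_cayley 1 hz h0)).sub
    (((hasDerivAt_oddSeries_cayley 0 hz h0).mul hM).const_mul 2)).add
    (((hL.mul hM).pow 2).div_const 2)).congr_deriv ?_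
  have e1 := oddSeries_one_sq hz
  have e2 := oddSeries_one_sq (cayley_norm_lt h0)
  rw [cayley_cayley h1] at e2
  simp only [zero_add, e1, e2, Pi.mul_apply, one_add_one_eq_two]
  ring

theorem tendsto_mul_clog_of_hasDerivAt {g : ℂ → ℂ} {g' : ℂ} (hg : HasDerivAt g g' 0)
    (h0 : g 0 = 0) : Tendsto (fun z => g z * Complex.log z) (𝓝[≠] 0) (𝓝 0) := by
  have h1 : g =O[𝓝[≠] 0] (fun z : ℂ => z) := by
    simpa [h0] using hg.isBigO_sub.mono nhdsWithin_le_nhds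
  refine (h1.mul (Asymptotics.isBigO_refl Complex.log (𝓝[≠] 0))).trans_tendsto ?_
  have hn : Tendsto (fun z : ℂ => ‖z‖) (𝓝[≠] 0) (𝓝[>] 0) := tendsto_norm_nhdsNE_zero
  have h2 : Tendsto (fun z : ℂ => |Real.log ‖z‖ * ‖z‖| + Real.pi * ‖z‖) (𝓝[≠] 0) (𝓝 0) := by
    have ha := (tendsto_log_mul_rpow_nhdsGT_zero one_pos).comp hn
    have hb := (hn.mono_right nhdsWithin_le_nhds).const_mul Real.pi
    simpa [Function.comp_def] using ha.abs.add hb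
  refine squeeze_zero_norm (fun z => ?_) h2
  rw [norm_mul]
  have h3 : ‖Complex.log z‖ ≤ |Real.log ‖z‖| + Real.pi := by
    refine (Complex.norm_le_abs_re_add_abs_im _).trans ?_
    rw [Complex.log_re, Complex.log_im]
    gcongr
    exact Complex.abs_arg_le_pi z
  rw [abs_mul, abs_of_nonneg (norm_nonneg z)]
  nlinarith [norm_nonneg z]

theorem continuousOn_oddSeries {k : ℕ} (hk : 2 ≤ k) :
    ContinuousOn (oddSeries ℂ k) (Metric.closedBall 0 1) := by
  refine continuousOn_powerSum ?_
  exact (summable_oddHarmonic_div hk).norm.congr fun n => (RCLike.norm_ofReal _).symm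

theorem tendsto_oddSeries {k : ℕ} (hk : 2 ≤ k) {l : Filter ℝ} {g : ℝ → ℂ} {c : ℂ}
    (hg : Tendsto g l (𝓝 c)) (hc : ‖c‖ ≤ 1) (hl : ∀ᶠ t in l, ‖g t‖ ≤ 1) :
    Tendsto (fun t => oddSeries ℂ k (g t)) l (𝓝 (oddSeries ℂ k c)) := by
  refine ((continuousOn_oddSeries hk) c (by simpa using hc)).tendsto.comp ?_
  exact tendsto_nhdsWithin_iff.2 ⟨hg, hl.mono fun t ht => by simpa using ht⟩

theorem oddSeries_zero (k : ℕ) : oddSeries ℂ k 0 = 0 := by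
  simp [oddSeries, powerSum_zero, oddHarmonic]

/-- The segment from `i` to `1`. -/
def segmentPath (t : ℝ) : ℂ := t + (1 - t) * Complex.I

theorem segmentPath_re (t : ℝ) : (segmentPath t).re = t := by simp [segmentPath]

theorem segmentPath_im (t : ℝ) : (segmentPath t).im = 1 - t := by simp [segmentPath]

theorem segmentPath_norm {t : ℝ} (ht : t ∈ Ioo (0 : ℝ) 1) : ‖segmentPath t‖ < 1 := by
  rw [← sq_lt_one_iff₀ (norm_nonneg _), ← Complex.normSq_eq_norm_sq, Complex.normSq_apply,
    segmentPath_re, segmentPath_im]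
  nlinarith [ht.1, ht.2]

theorem continuous_segmentPath : Continuous segmentPath := by unfold segmentPath; fun_prop

theorem hasDerivAt_segmentPath (t : ℝ) : HasDerivAt segmentPath (1 - Complex.I) t := by
  have h := (Complex.ofRealCLM.hasDerivAt (x := t))
  simp only [Complex.ofRealCLM_apply, Complex.ofReal_one] at h
  have h2 : HasDerivAt segmentPath (1 + -1 * Complex.I) t :=
    h.add ((h.const_sub 1).mul_const Complex.I)
  exact h2.congr_deriv (by ring)

/-- The invariant is compared at the ends of the segment from i to 1, whose interior lies in the
right half of the disc. At i both squares equal -1; at 1 they are 1 and 0. -/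
theorem oddSeries_three_complex :
    2 * oddSeries ℂ 3 (-1) + (Real.pi : ℂ) ^ 4 / 32 = oddSeries ℂ 3 1 := by
  have hI : 1 + Complex.I ≠ 0 := by
    intro h; have := congrArg Complex.re h; simp at this
  have hz0 : segmentPath 0 = Complex.I := by simp [segmentPath]
  have hz1 : segmentPath 1 = 1 := by simp [segmentPath]
  have hw0 : (1 - Complex.I) / (1 + Complex.I) = -Complex.I := by
    rw [div_eq_iff hI]; linear_combination Complex.I_sq
  have hlt : ∀ t ∈ Ioo (0 : ℝ) 1, 0 < (segmentPath t).re := fun t ht => by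
    rw [segmentPath_re]; exact ht.1
  have h0 : ∀ᶠ t in 𝓝[>] (0 : ℝ), t ∈ Ioo (0 : ℝ) 1 := Ioo_mem_nhdsGT one_pos
  have h1 : ∀ᶠ t in 𝓝[<] (1 : ℝ), t ∈ Ioo (0 : ℝ) 1 := Ioo_mem_nhdsLT one_pos
  have bz : ∀ t ∈ Ioo (0 : ℝ) 1, ‖segmentPath t ^ 2‖ ≤ 1 := fun t ht =>
    (norm_sq_lt_one (segmentPath_norm ht)).le
  have bw : ∀ t ∈ Ioo (0 : ℝ) 1, ‖((1 - segmentPath t) / (1 + segmentPath t)) ^ 2‖ ≤ 1 :=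
    fun t ht => (norm_sq_lt_one (cayley_norm_lt (hlt t ht))).le
  refine limits_eq_of_hasDerivAt_zero (f := fun t => cayleyInvariant (segmentPath t))
    one_pos (fun t ht => ?_) ?_ ?_
  · have := (hasDerivAt_cayleyInvariant (segmentPath_norm ht) (hlt t ht)).scomp t
      (hasDerivAt_segmentPath t)
    exact this.congr_deriv (by simp)
  · have tz : Tendsto segmentPath (𝓝[>] 0) (𝓝 Complex.I) := by
      rw [← hz0]; exact continuous_segmentPath.continuousAt.tendsto.mono_left nhdsWithin_le_nhds
    have tw : Tendsto (fun t => (1 - segmentPath t) / (1 + segmentPath t)) (𝓝[>] 0)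
        (𝓝 (-Complex.I)) := by
      rw [← hw0]; exact (tz.const_sub 1).div (tz.const_add 1) hI
    have tz2 := tz.pow 2
    have tw2 := tw.pow 2
    rw [Complex.I_sq] at tz2
    rw [neg_sq, Complex.I_sq] at tw2
    have lz := tz.clog (Or.inr (by simp) : Complex.I ∈ Complex.slitPlane)
    have lw := tw.clog (Or.inr (by simp) : -Complex.I ∈ Complex.slitPlane)
    have n1 : ‖(-1 : ℂ)‖ ≤ 1 := by simp
    have e0z := h0.mono bz
    have e0w := h0.mono bw
    have h := ((((tendsto_oddSeries (k := 3) (by norm_num) tz2 n1 e0z).sub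
      (((tendsto_oddSeries (k := 2) (by norm_num) tz2 n1 e0z).mul lz).const_mul 2)).add
      (tendsto_oddSeries (k := 3) (by norm_num) tw2 n1 e0w)).sub
      (((tendsto_oddSeries (k := 2) (by norm_num) tw2 n1 e0w).mul lw).const_mul 2)).add
      (((lz.mul lw).pow 2).div_const 2)
    -- The two logarithms add to 0, which removes the weight-two values at -1, and their product is
    -- π²/4, which leaves π⁴/32.
    rw [Complex.log_I, Complex.log_neg_I] at h
    refine h.trans (le_of_eq (congrArg 𝓝 ?_))
    linear_combination ((Real.pi : ℂ) ^ 4 / 32) * (Complex.I ^ 2 - 1) * Complex.I_sq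
  · have tz : Tendsto segmentPath (𝓝[<] 1) (𝓝 1) := by
      rw [← hz1]; exact continuous_segmentPath.continuousAt.tendsto.mono_left nhdsWithin_le_nhds
    have tw : Tendsto (fun t => (1 - segmentPath t) / (1 + segmentPath t)) (𝓝[<] 1) (𝓝 0) := by
      have h : Tendsto (fun t => (1 - segmentPath t) / (1 + segmentPath t)) (𝓝[<] 1) _ :=
        (tz.const_sub 1).div (tz.const_add 1) (by norm_num)
      simpa using h
    have twne : Tendsto (fun t => (1 - segmentPath t) / (1 + segmentPath t)) (𝓝[<] 1)
        (𝓝[≠] 0) := by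
      refine tendsto_nhdsWithin_iff.2 ⟨tw, h1.mono fun t ht => ?_⟩
      have hn := segmentPath_norm ht
      exact div_ne_zero (one_sub_ne_zero_of_norm hn) (one_add_ne_zero_of_norm hn)
    have tz2 := tz.pow 2
    have tw2 := tw.pow 2
    rw [one_pow] at tz2
    rw [zero_pow two_ne_zero] at tw2
    have lz := tz.clog (Or.inl (by simp) : (1 : ℂ) ∈ Complex.slitPlane)
    rw [Complex.log_one] at lz
    have e1z := h1.mono bz
    have e1w := h1.mono bw
    have d1 : HasDerivAt (fun w => oddSeries ℂ 2 (w ^ 2)) _ 0 :=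
      hasDerivAt_powerSum_sq (norm_oddHarmonic_div_le one_le_two) (by simp)
    have t1 := (tendsto_mul_clog_of_hasDerivAt d1 (by simp [oddSeries_zero])).comp twne
    have t2 := (tendsto_mul_clog_of_hasDerivAt (hasDerivAt_log_cayley (z := 0) (by simp))
      (by simp)).comp twne
    -- Here z is the Cayley transform of w, so log z vanishes to first order as w → 0 and outweighs
    -- log w.
    have t3 : Tendsto (fun t => Complex.log (segmentPath t)
        * Complex.log ((1 - segmentPath t) / (1 + segmentPath t))) (𝓝[<] 1) (𝓝 0) := by
      refine t2.congr' (h1.mono fun t ht => ?_)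
      simp only [Function.comp_apply]
      rw [cayley_cayley (one_add_ne_zero_of_norm (segmentPath_norm ht))]
    have h := ((((tendsto_oddSeries (k := 3) (by norm_num) tz2 (by simp) e1z).sub
      (((tendsto_oddSeries (k := 2) (by norm_num) tz2 (by simp) e1z).mul lz).const_mul 2)).add
      (tendsto_oddSeries (k := 3) (by norm_num) tw2 (by simp) e1w)).sub
      (t1.const_mul 2)).add ((t3.pow 2).div_const 2)
    refine h.trans (le_of_eq (congrArg 𝓝 ?_))
    simp [oddSeries_zero]

theorem oddSeries_ofReal (k : ℕ) (x : ℝ) :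
    oddSeries ℂ k (x : ℂ) = ((oddSeries ℝ k x : ℝ) : ℂ) := by
  rw [oddSeries, oddSeries, powerSum, powerSum, Complex.ofReal_tsum]
  exact tsum_congr fun n => by simp

end Complex

theorem oddSeries_three_neg_one :
    2 * oddSeries ℝ 3 (-1) + Real.pi ^ 4 / 32 = oddSeries ℝ 3 1 := by
  have h := oddSeries_three_complex
  have h1 := oddSeries_ofReal 3 1
  have h2 := oddSeries_ofReal 3 (-1)
  push_cast at h1 h2
  rw [h1, h2] at h
  exact_mod_cast h

/-- Deleting the even terms from H_{2n} costs H_n/2. The last terms 1/(2n) and (1/n)/2 cancel, so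
the truncated sums serve equally well. -/
theorem oddHarmonic_eq (n : ℕ) : oddHarmonic n = harmonicPred (2 * n) - harmonicPred n / 2 := by
  rcases n.eq_zero_or_pos with rfl | hn
  · simp [oddHarmonic, harmonicPred]
  suffices h : ∀ n, oddHarmonic (n + 1) = harmonicPred (2 * n + 2) - harmonicPred (n + 1) / 2 by
    obtain ⟨m, rfl⟩ := Nat.exists_eq_succ_of_ne_zero hn.ne'
    exact h m
  intro n
  induction n with
  | zero => simp [oddHarmonic, harmonicPred, Finset.sum_range_succ]
  | succ n ih =>
    have e1 : oddHarmonic (n + 1 + 1) = oddHarmonic (n + 1) + 1 / (2 * ((n : ℝ) + 1) + 1) := by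
      rw [oddHarmonic, Finset.sum_range_succ, ← oddHarmonic]; push_cast; rfl
    have e2 : harmonicPred (2 * (n + 1) + 2)
        = harmonicPred (2 * n + 2) + 1 / (2 * (n : ℝ) + 2) + 1 / (2 * (n : ℝ) + 3) := by
      rw [show 2 * (n + 1) + 2 = 2 * n + 2 + 1 + 1 by ring, harmonicPred, Finset.sum_range_succ,
        Finset.sum_range_succ, ← harmonicPred]
      push_cast; ring
    have e3 : harmonicPred (n + 1 + 1) = harmonicPred (n + 1) + 1 / ((n : ℝ) + 1) := by
      rw [harmonicPred, Finset.sum_range_succ, ← harmonicPred]; push_cast; rfl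
    rw [e1, e2, e3, ih]
    have h1 : (n : ℝ) + 1 ≠ 0 := by positivity
    have h2 : 2 * (n : ℝ) + 3 ≠ 0 := by positivity
    have h3 : 2 * ((n : ℝ) + 1) + 1 ≠ 0 := by positivity
    have h4 : 2 * (n : ℝ) + 2 ≠ 0 := by positivity
    field_simp
    ring

/-- The part of ∑ H_{n-1}/n³ with even n is the mean of the plain and the alternating sums. -/
theorem oddSeries_three_one :
    oddSeries ℝ 3 1 = 7 / 8 * liSeries 4 1 + 4 * nielsen 3 (-1) := by
  have hs : Summable fun n : ℕ => harmonicPred n / (n : ℝ) ^ 3 :=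
    summable_harmonicPred_div (by norm_num)
  have h := tsum_even_odd_alternating hs
  have h1 : nielsen 3 1 = ∑' n : ℕ, harmonicPred n / (n : ℝ) ^ 3 := by simp [nielsen, powerSum]
  have h2 : nielsen 3 (-1) = ∑' n : ℕ, harmonicPred n / (n : ℝ) ^ 3 * (-1) ^ n := rfl
  have he : Summable fun n : ℕ => harmonicPred (2 * n) / ((2 * n : ℕ) : ℝ) ^ 3 :=
    hs.comp_injective (mul_right_injective₀ two_ne_zero)
  have h3 : oddSeries ℝ 3 1 = 8 * ∑' n : ℕ, harmonicPred (2 * n) / ((2 * n : ℕ) : ℝ) ^ 3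
      - 1 / 2 * ∑' n : ℕ, harmonicPred n / (n : ℝ) ^ 3 := by
    rw [← tsum_mul_left, ← tsum_mul_left, ← (he.mul_left 8).tsum_sub (hs.mul_left (1 / 2))]
    refine tsum_congr fun n => ?_
    beta_reduce
    rw [one_pow, mul_one, oddHarmonic_eq, RCLike.ofReal_real_eq_id, id]
    push_cast
    rw [mul_pow]
    ring
  rw [h3]
  rw [← h1, ← h2] at h
  rw [← h1]
  linear_combination (-4 : ℝ) * h + 7 / 2 * nielsen_three_one

theorem liSeries_four_one : liSeries 4 1 = Real.pi ^ 4 / 90 := by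
  have h := hasSum_zeta_four.tsum_eq
  simpa [liSeries, powerSum] using h

theorem oddSeries_three_neg_one_eq :
    -oddSeries ℝ 3 (-1) / 4
      = 1 / 2 * (11 / 4 * zetaValue 4 - 7 / 4 * zetaValue 3 * Real.log 2
          + 1 / 2 * zetaValue 2 * Real.log 2 ^ 2 - 1 / 12 * Real.log 2 ^ 4
          - 2 * polylog 4 (1 / 2)) - 25 / 128 * zetaValue 4 := by
  have h1 := oddSeries_three_neg_one
  have h2 := oddSeries_three_one
  have h3 := nielsen_three_neg_one_eq
  have h4 := liSeries_four_one
  rw [zetaValue_eq le_rfl, zetaValue_eq (k := 3) (by norm_num), zetaValue_eq (k := 4) (by norm_num),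
    polylog_eq (k := 3) (by norm_num [abs_of_pos])]
  linear_combination (-1 / 8 : ℝ) * h1 - 1 / 8 * h2 - 1 / 2 * h3 - 90 / 256 * h4

/-! ### A double series summed in two orders -/

section MixedDoubleSum

theorem hasSum_alternating_odd_cube :
    HasSum (fun n : ℕ => (-1 : ℝ) ^ n / (2 * (n : ℝ) + 1) ^ 3) (Real.pi ^ 3 / 32) := by
  have h := hasSum_L_function_mod_four_eval_three
  have hinj : Function.Injective fun n : ℕ => 2 * n + 1 := fun a b h => by simpa using h
  have h2 := (hinj.hasSum_iff (f := fun n : ℕ => (1 : ℝ) / (n : ℝ) ^ 3 *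
    Real.sin (Real.pi * n / 2)) fun x hx => ?_).2 h
  · refine hasSum_of_eq h2 fun n => ?_
    have : Real.sin (Real.pi * ((2 * n + 1 : ℕ) : ℝ) / 2) = (-1) ^ n := by
      rw [show Real.pi * ((2 * n + 1 : ℕ) : ℝ) / 2 = Real.pi / 2 + n * Real.pi by push_cast; ring,
        Real.sin_add_nat_mul_pi, Real.sin_pi_div_two, mul_one]
    simp only [Function.comp_apply]
    rw [this]
    push_cast
    ring
  · rcases Nat.even_or_odd' x with ⟨c, rfl | rfl⟩
    · rw [show Real.pi * ((2 * c : ℕ) : ℝ) / 2 = c * Real.pi by push_cast; ring,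
        Real.sin_nat_mul_pi, mul_zero]
    · exact absurd ⟨c, rfl⟩ hx

theorem tendsto_harmonicPred_sub_log :
    Tendsto (fun n : ℕ => harmonicPred n - Real.log n) atTop (𝓝 Real.eulerMascheroniConstant) := by
  have h1 : ∀ n : ℕ, harmonicPred n - Real.log n
      = ((harmonic n : ℝ) - Real.log n) - 1 / (n : ℝ) := by
    intro n
    have : ((harmonic n : ℚ) : ℝ) = harmonicPred (n + 1) := by
      rw [harmonicPred_succ, harmonic]; push_cast; simp
    have e : harmonicPred (n + 1) = harmonicPred n + 1 / (n : ℝ) := by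
      rw [harmonicPred, Finset.sum_range_succ, ← harmonicPred]
    rw [this, e]
    ring
  simp only [h1]
  simpa using Real.tendsto_harmonic_sub_log.sub tendsto_one_div_atTop_nhds_zero_nat

/-- By `oddHarmonic_eq` the difference is that of truncated harmonic numbers at 2n and n, so Euler's
constant cancels and log(2n) - log n remains. -/
theorem tendsto_oddHarmonic_sub :
    Tendsto (fun n : ℕ => oddHarmonic n - harmonicPred n / 2) atTop (𝓝 (Real.log 2)) := by
  have h2 : Tendsto (fun n : ℕ => 2 * n) atTop atTop := tendsto_id.const_mul_atTop' two_pos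
  have h := ((tendsto_harmonicPred_sub_log.comp h2).sub tendsto_harmonicPred_sub_log).add_const
    (Real.log 2)
  rw [sub_self, zero_add] at h
  refine h.congr' ?_
  filter_upwards [eventually_gt_atTop 0] with n hn
  have hn' : (n : ℝ) ≠ 0 := by exact_mod_cast hn.ne'
  simp only [Function.comp_apply]
  rw [oddHarmonic_eq]
  push_cast
  rw [Real.log_mul two_ne_zero hn']
  ring

theorem tendsto_harmonicPred_add_sub (c : ℕ) :
    Tendsto (fun n : ℕ => harmonicPred (n + c) - harmonicPred n) atTop (𝓝 0) := by
  induction c with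
  | zero => simp
  | succ c ih =>
    have h1 : Tendsto (fun n : ℕ => 1 / ((n + c : ℕ) : ℝ)) atTop (𝓝 0) :=
      tendsto_one_div_atTop_nhds_zero_nat.comp (tendsto_add_atTop_nat c)
    have h := ih.add h1
    rw [add_zero] at h
    refine h.congr fun n => ?_
    rw [← add_assoc n c 1, harmonicPred, harmonicPred, harmonicPred, Finset.sum_range_succ]
    ring

/-- The denominators run over the odd integers from -(2n-1) to 2K-1. -/
theorem sum_one_div_shifted_odd (n K : ℕ) :
    ∑ m ∈ Finset.range (n + K), 1 / (2 * ((m : ℝ) - n) + 1) = oddHarmonic K - oddHarmonic n := by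
  induction n with
  | zero => simp [oddHarmonic]
  | succ n ih =>
    rw [show n + 1 + K = n + K + 1 by ring, Finset.sum_range_succ']
    have e1 : oddHarmonic (n + 1) = oddHarmonic n + 1 / (2 * (n : ℝ) + 1) := by
      rw [oddHarmonic, Finset.sum_range_succ, ← oddHarmonic]
    have e2 : ∑ m ∈ Finset.range (n + K), 1 / (2 * (((m + 1 : ℕ) : ℝ) - ((n + 1 : ℕ) : ℝ)) + 1)
        = ∑ m ∈ Finset.range (n + K), 1 / (2 * ((m : ℝ) - n) + 1) :=
      Finset.sum_congr rfl fun m _ => by push_cast; ring_nf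
    rw [e2, ih, e1]
    have h1 : 2 * (n : ℝ) + 1 ≠ 0 := by positivity
    have e3 : 2 * (((0 : ℕ) : ℝ) - ((n + 1 : ℕ) : ℝ)) + 1 = -(2 * (n : ℝ) + 1) := by
      push_cast; ring
    rw [e3, one_div_neg_eq_neg_one_div]
    ring

theorem sum_one_div_odd_add (c K : ℕ) :
    ∑ m ∈ Finset.range K, 1 / (2 * ((m : ℝ) + c) + 1) = oddHarmonic (c + K) - oddHarmonic c := by
  rw [oddHarmonic, oddHarmonic, Finset.sum_range_add, add_sub_cancel_left]
  exact Finset.sum_congr rfl fun m _ => by push_cast; ring_nf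

/-- Partial sums of Leibniz's series. -/
def leibnizSum (n : ℕ) : ℝ := ∑ i ∈ Finset.range n, (-1 : ℝ) ^ i / (2 * (i : ℝ) + 1)

theorem sum_alternating_shifted_odd (r K : ℕ) :
    ∑ j ∈ Finset.range (r + K), (-1 : ℝ) ^ j / (2 * ((r : ℝ) - j) - 1)
      = -(-1) ^ r * (leibnizSum r + leibnizSum K) := by
  induction r with
  | zero =>
    simp only [leibnizSum, zero_add, Nat.cast_zero, Finset.range_zero, Finset.sum_empty, pow_zero,
      neg_mul, one_mul, ← Finset.sum_neg_distrib]
    refine Finset.sum_congr rfl fun j _ => ?_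
    rw [show 2 * (0 - (j : ℝ)) - 1 = -(2 * j + 1) by ring, div_neg]
  | succ r ih =>
    rw [show r + 1 + K = r + K + 1 by ring, Finset.sum_range_succ']
    have e2 : ∑ j ∈ Finset.range (r + K), (-1 : ℝ) ^ (j + 1) /
        (2 * (((r + 1 : ℕ) : ℝ) - ((j + 1 : ℕ) : ℝ)) - 1)
        = -∑ j ∈ Finset.range (r + K), (-1 : ℝ) ^ j / (2 * ((r : ℝ) - j) - 1) := by
      rw [← Finset.sum_neg_distrib]
      exact Finset.sum_congr rfl fun j _ => by push_cast; ring_nf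
    have e1 : leibnizSum (r + 1) = leibnizSum r + (-1) ^ r / (2 * (r : ℝ) + 1) := by
      rw [leibnizSum, Finset.sum_range_succ, ← leibnizSum]
    have e3 : 2 * (((r + 1 : ℕ) : ℝ) - ((0 : ℕ) : ℝ)) - 1 = 2 * (r : ℝ) + 1 := by
      push_cast; ring
    rw [e2, ih, e1, e3, pow_succ]
    have h4 : ((-1 : ℝ) ^ r) * (-1) ^ r = 1 := by rw [← mul_pow]; norm_num
    linear_combination -(1 / (2 * (r : ℝ) + 1)) * h4

theorem sum_alternating_odd_add (c K : ℕ) :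
    ∑ j ∈ Finset.range K, (-1 : ℝ) ^ j / (2 * ((j : ℝ) + c) + 1)
      = (-1) ^ c * (leibnizSum (c + K) - leibnizSum c) := by
  rw [leibnizSum, leibnizSum, Finset.sum_range_add, add_sub_cancel_left, Finset.mul_sum]
  refine Finset.sum_congr rfl fun m _ => ?_
  have h4 : ((-1 : ℝ) ^ c) * (-1) ^ c = 1 := by rw [← mul_pow]; norm_num
  push_cast
  rw [pow_add, ← mul_div_assoc, ← mul_assoc, h4, one_mul]
  ring_nf

/-- The summand of the double series whose two iterated sums give the mixed Euler sum. -/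
def mixedTerm (x : ℕ × ℕ) : ℝ :=
  (-1) ^ x.1 / ((2 * (x.1 : ℝ) + 1) * (2 * (x.2 : ℝ) + 2) *
    ((2 * (x.2 : ℝ) + 2) ^ 2 - (2 * (x.1 : ℝ) + 1) ^ 2))

theorem sub_odd_ne_zero (n m : ℕ) : 2 * ((m : ℝ) - n) + 1 ≠ 0 := by
  intro h
  have : (2 * ((m : ℤ) - n) + 1) = 0 := by exact_mod_cast h
  omega

theorem one_le_abs_sub_odd (n m : ℕ) : 1 ≤ |2 * ((m : ℝ) - n) + 1| := by
  have : 1 ≤ |2 * ((m : ℤ) - n) + 1| := by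
    rw [le_abs]; omega
  exact_mod_cast this

theorem summable_one_div_mul_sqrt :
    Summable fun n : ℕ => 1 / (((n : ℝ) + 1) * √((n : ℝ) + 1)) := by
  have h := (summable_nat_add_iff 1).2
    (Real.summable_one_div_nat_rpow.2 (by norm_num : (1 : ℝ) < 3 / 2))
  refine h.congr fun n => ?_
  have hn0 : (0 : ℝ) < (n : ℝ) + 1 := by positivity
  push_cast
  rw [Real.sqrt_eq_rpow]
  nth_rw 2 [← Real.rpow_one ((n : ℝ) + 1)]
  rw [← Real.rpow_add hn0]
  norm_num

/-- An even q and an odd p differ by at least 1, so |q² - p²| ≥ q + p, which dominates √(n+1) √(m+1)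
and splits the bound into a product of two convergent series. -/
theorem summable_mixedTerm : Summable mixedTerm := by
  have hs := summable_one_div_mul_sqrt
  have h := summable_mul_of_summable_norm hs.norm hs.norm
  refine Summable.of_norm_bounded h fun ⟨n, m⟩ => ?_
  simp only [mixedTerm]
  set p : ℝ := 2 * (n : ℝ) + 1 with hp
  set q : ℝ := 2 * (m : ℝ) + 2 with hq
  have hn : (n : ℝ) + 1 ≤ p := by rw [hp]; linarith [(n.cast_nonneg : (0 : ℝ) ≤ n)]
  have hm : (m : ℝ) + 1 ≤ q := by rw [hq]; linarith [(m.cast_nonneg : (0 : ℝ) ≤ m)]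
  have hn0 : (0 : ℝ) < (n : ℝ) + 1 := by positivity
  have hm0 : (0 : ℝ) < (m : ℝ) + 1 := by positivity
  have hp0 : 0 < p := by linarith
  have hq0 : 0 < q := by linarith
  have h1 : 1 ≤ |q - p| := by
    have := one_le_abs_sub_odd n m
    rwa [show 2 * ((m : ℝ) - n) + 1 = q - p by rw [hp, hq]; ring] at this
  have h2 : √((n : ℝ) + 1) * √((m : ℝ) + 1) ≤ |q ^ 2 - p ^ 2| := by
    calc √((n : ℝ) + 1) * √((m : ℝ) + 1) ≤ q + p := by
          have a1 := Real.sq_sqrt hn0.le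
          have a2 := Real.sq_sqrt hm0.le
          nlinarith [sq_nonneg (√((n : ℝ) + 1) - √((m : ℝ) + 1)), Real.sqrt_nonneg ((n : ℝ) + 1),
            Real.sqrt_nonneg ((m : ℝ) + 1)]
      _ ≤ (q + p) * |q - p| := le_mul_of_one_le_right (by positivity) h1
      _ = |q ^ 2 - p ^ 2| := by
          rw [show q ^ 2 - p ^ 2 = (q + p) * (q - p) by ring, abs_mul, abs_of_pos (a := q + p)]
          positivity
  rw [norm_div, norm_pow, norm_neg, norm_one, one_pow, norm_mul, norm_mul, Real.norm_of_nonneg hp0.le,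
    Real.norm_of_nonneg hq0.le, Real.norm_eq_abs, one_div_mul_one_div]
  refine one_div_le_one_div_of_le (by positivity) ?_
  calc ((n : ℝ) + 1) * √((n : ℝ) + 1) * (((m : ℝ) + 1) * √((m : ℝ) + 1))
      = ((n : ℝ) + 1) * ((m : ℝ) + 1) * (√((n : ℝ) + 1) * √((m : ℝ) + 1)) := by ring
    _ ≤ p * q * |q ^ 2 - p ^ 2| := by gcongr

/-- With p = 2n+1 and q = 2m+2, 1/(q(q²-p²)) = (1/(q-p) + 1/(q+p) - 2/q) / (2p²); the partial sums
are odd harmonic numbers minus a harmonic number, with limit involving 2 log 2. -/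
theorem hasSum_mixedTerm_fst (n : ℕ) :
    HasSum (fun m => mixedTerm (n, m)) ((-1) ^ n / (2 * (n : ℝ) + 1) ^ 3 *
      (Real.log 2 - oddHarmonic n - 1 / (2 * (2 * (n : ℝ) + 1)))) := by
  have hs := summable_mixedTerm.prod_factor n
  refine hs.hasSum_iff_tendsto_nat.2 ((tendsto_add_atTop_iff_nat n).1 ?_)
  have hp : 2 * (n : ℝ) + 1 ≠ 0 := by positivity
  have e1 : oddHarmonic (n + 1) = oddHarmonic n + 1 / (2 * (n : ℝ) + 1) := by
    rw [oddHarmonic, Finset.sum_range_succ, ← oddHarmonic]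
  have hfin : ∀ K, ∑ m ∈ Finset.range (K + n), mixedTerm (n, m)
      = (-1) ^ n / (2 * (2 * (n : ℝ) + 1) ^ 3) *
        ((oddHarmonic K - oddHarmonic n) + (oddHarmonic (K + (2 * n + 1)) - oddHarmonic (n + 1))
          - harmonicPred (K + (n + 1))) := by
    intro K
    rw [← add_assoc K n 1, harmonicPred_succ, show K + (2 * n + 1) = n + 1 + (K + n) by ring,
      ← sum_one_div_odd_add, ← sum_one_div_shifted_odd, add_comm n K, ← Finset.sum_add_distrib,
      ← Finset.sum_sub_distrib, Finset.mul_sum]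
    refine Finset.sum_congr rfl fun m _ => ?_
    have h1 := sub_odd_ne_zero n m
    have h2 : 2 * ((m : ℝ) + ((n + 1 : ℕ) : ℝ)) + 1 ≠ 0 := by positivity
    have h3 : (m : ℝ) + 1 ≠ 0 := by positivity
    have h4 : (2 * (m : ℝ) + 2) ^ 2 - (2 * (n : ℝ) + 1) ^ 2
        = (2 * ((m : ℝ) - n) + 1) * (2 * ((m : ℝ) + ((n + 1 : ℕ) : ℝ)) + 1) := by push_cast; ring
    have h5 : 2 * (m : ℝ) + 2 = 2 * (m + 1) := by ring
    simp only [mixedTerm]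
    rw [h4, h5]
    field_simp
    push_cast
    ring
  simp only [hfin]
  have hlim : Tendsto (fun K => oddHarmonic K + oddHarmonic (K + (2 * n + 1))
      - harmonicPred (K + (n + 1))) atTop (𝓝 (2 * Real.log 2)) := by
    have h := ((tendsto_oddHarmonic_sub.add
      (tendsto_oddHarmonic_sub.comp (tendsto_add_atTop_nat (2 * n + 1)))).add
      ((tendsto_harmonicPred_add_sub (2 * n + 1)).div_const 2)).sub
      (tendsto_harmonicPred_add_sub (n + 1))
    rw [zero_div, add_zero, sub_zero, ← two_mul] at h
    refine h.congr fun K => ?_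
    simp only [Function.comp_apply]
    ring
  have h := (hlim.sub_const (oddHarmonic n + oddHarmonic (n + 1))).const_mul
    ((-1) ^ n / (2 * (2 * (n : ℝ) + 1) ^ 3))
  rw [e1] at h
  have hval : (-1) ^ n / (2 * (2 * (n : ℝ) + 1) ^ 3) *
      (2 * Real.log 2 - (oddHarmonic n + (oddHarmonic n + 1 / (2 * (n : ℝ) + 1))))
      = (-1) ^ n / (2 * (n : ℝ) + 1) ^ 3 *
      (Real.log 2 - oddHarmonic n - 1 / (2 * (2 * (n : ℝ) + 1))) := by
    field_simp
    ring
  rw [hval] at h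
  refine h.congr fun K => ?_
  rw [e1]
  ring

/-- Now 1/(p(q²-p²)) = (1/p + (1/(q-p) - 1/(q+p))/2) / q², and each alternating sum over n is a
piece of Leibniz's series. The finite pieces cancel, leaving multiples of π/4. -/
theorem hasSum_mixedTerm_snd (m : ℕ) :
    HasSum (fun n => mixedTerm (n, m))
      (Real.pi / 32 * (1 / ((m : ℝ) + 1) ^ 3 - 1 / ((m : ℝ) + 1) ^ 3 * (-1) ^ (m + 1))) := by
  have hs : Summable fun n => mixedTerm (n, m) := summable_mixedTerm.prod_symm.prod_factor m
  refine hs.hasSum_iff_tendsto_nat.2 ((tendsto_add_atTop_iff_nat (m + 1)).1 ?_)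
  have hm : (m : ℝ) + 1 ≠ 0 := by positivity
  have hfin : ∀ K, ∑ n ∈ Finset.range (K + (m + 1)), mixedTerm (n, m)
      = 1 / (8 * ((m : ℝ) + 1) ^ 3) * (leibnizSum (K + (m + 1))
        + 1 / 2 * (-(-1) ^ (m + 1) * (leibnizSum (m + 1) + leibnizSum K)
        - (-1) ^ (m + 1) * (leibnizSum (K + (2 * m + 2)) - leibnizSum (m + 1)))) := by
    intro K
    rw [show K + (2 * m + 2) = m + 1 + (K + (m + 1)) by ring,
      ← sum_alternating_odd_add, ← sum_alternating_shifted_odd, add_comm (m + 1) K,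
      ← Finset.sum_sub_distrib, Finset.mul_sum, leibnizSum, ← Finset.sum_add_distrib,
      Finset.mul_sum]
    refine Finset.sum_congr rfl fun n _ => ?_
    have h1 := sub_odd_ne_zero n m
    have h2 : 2 * ((n : ℝ) + ((m + 1 : ℕ) : ℝ)) + 1 ≠ 0 := by positivity
    have h3 : 2 * (n : ℝ) + 1 ≠ 0 := by positivity
    have h4 : (2 * (m : ℝ) + 2) ^ 2 - (2 * (n : ℝ) + 1) ^ 2
        = (2 * ((m : ℝ) - n) + 1) * (2 * ((n : ℝ) + ((m + 1 : ℕ) : ℝ)) + 1) := by push_cast; ring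
    have h5 : 2 * (m : ℝ) + 2 = 2 * (m + 1) := by ring
    have h6 : 2 * (((m + 1 : ℕ) : ℝ) - n) - 1 = 2 * ((m : ℝ) - n) + 1 := by push_cast; ring
    simp only [mixedTerm]
    rw [h4, h5, h6]
    field_simp
    push_cast
    ring
  simp only [hfin]
  have hl : Tendsto leibnizSum atTop (𝓝 (Real.pi / 4)) := Real.tendsto_sum_pi_div_four
  have h := ((hl.comp (tendsto_add_atTop_nat (m + 1))).add
    ((((hl.const_add (leibnizSum (m + 1))).const_mul (-(-1) ^ (m + 1))).sub
    (((hl.comp (tendsto_add_atTop_nat (2 * m + 2))).sub_const (leibnizSum (m + 1))).const_mul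
      ((-1) ^ (m + 1)))).const_mul (1 / 2))).const_mul (1 / (8 * ((m : ℝ) + 1) ^ 3))
  refine h.trans (le_of_eq (congrArg 𝓝 ?_))
  field_simp
  ring

end MixedDoubleSum

/-- The value of `∑ 2 (-1) ^ (n + 1) h_n / (2 n + 1) ^ 3`. -/
theorem tsum_oddHarmonic_odd_cube :
    HasSum (fun n : ℕ => (-1 : ℝ) ^ (n + 1) * (2 * oddHarmonic n) / (2 * (n : ℝ) + 1) ^ 3)
      (7 * Real.pi / 64 * zetaValue 3 + dirichletBeta 4 - Real.pi ^ 3 / 16 * Real.log 2) := by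
  have hF := summable_mixedTerm.hasSum
  have h1 := hF.prod_fiberwise hasSum_mixedTerm_fst
  have h2 := ((Equiv.prodComm ℕ ℕ).hasSum_iff.2 hF).prod_fiberwise hasSum_mixedTerm_snd
  have hz : HasSum (fun m : ℕ => 1 / ((m : ℝ) + 1) ^ 3) (liSeries 3 1) := by
    have h : HasSum (fun n : ℕ => 1 / (n : ℝ) ^ 3) (liSeries 3 1) := by
      have := (Real.summable_one_div_nat_pow.2 (by norm_num : 1 < 3)).hasSum
      simpa [liSeries, powerSum] using this
    rw [← hasSum_nat_add_iff' 1] at h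
    simpa using h
  have hz' : HasSum (fun m : ℕ => 1 / ((m : ℝ) + 1) ^ 3 * (-1) ^ (m + 1)) (liSeries 3 (-1)) := by
    have h : HasSum (fun n : ℕ => 1 / (n : ℝ) ^ 3 * (-1) ^ n) (liSeries 3 (-1)) := by
      have : Summable (fun n : ℕ => 1 / (n : ℝ) ^ 3 * (-1) ^ n) :=
        Summable.of_norm_bounded (Real.summable_one_div_nat_pow.2 (by norm_num : 1 < 3))
          fun n => by simp
      exact this.hasSum
    rw [← hasSum_nat_add_iff' 1] at h
    simpa using h
  have e2 := h2.unique ((hz.sub hz').mul_left (Real.pi / 32))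
  rw [liSeries_neg_one (by norm_num)] at e2
  have hb4 : HasSum (fun n : ℕ => (-1 : ℝ) ^ n / (2 * (n : ℝ) + 1) ^ 4) (dirichletBeta 4) := by
    refine Summable.hasSum ?_
    refine Summable.of_norm_bounded ((summable_nat_add_iff 1).2
      (Real.summable_one_div_nat_pow.2 (by norm_num : 1 < 4))) fun n => ?_
    rw [norm_div, norm_pow, norm_neg, norm_one, one_pow, Real.norm_of_nonneg (by positivity)]
    push_cast
    gcongr
    linarith [(n.cast_nonneg : (0 : ℝ) ≤ n)]
  -- Subtracting log 2 times the cubic series isolates h_n; after doubling, the correction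
  -- 1/(2(2n+1)) contributes -β(4), which is added back.
  have h3 := ((h1.sub (hasSum_alternating_odd_cube.mul_left (Real.log 2))).mul_left 2).add hb4
  rw [zetaValue_eq (by norm_num)]
  rw [e2] at h3
  have hval : 2 * (Real.pi / 32 * (liSeries 3 1 - -(1 - 2 / 2 ^ 3) * liSeries 3 1)
      - Real.log 2 * (Real.pi ^ 3 / 32)) + dirichletBeta 4
      = 7 * Real.pi / 64 * liSeries 3 1 + dirichletBeta 4 - Real.pi ^ 3 / 16 * Real.log 2 := by ring
  rw [hval] at h3
  refine hasSum_of_eq h3 fun n => ?_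
  have h1 : 2 * (n : ℝ) + 1 ≠ 0 := by positivity
  field_simp
  ring

/-! ### Polygamma functions and half-step differences -/

section Polygamma

theorem analyticAt_Gamma {x : ℝ} (hx : 0 < x) : AnalyticAt ℝ Real.Gamma x := by
  have h1 : DifferentiableOn ℂ Complex.Gamma {z : ℂ | 0 < z.re} := fun z hz =>
    (Complex.differentiableAt_Gamma z fun m h => by
      have hz' : 0 < z.re := hz
      rw [h] at hz'
      simp at hz'
      linarith [(m.cast_nonneg : (0 : ℝ) ≤ m)]).differentiableWithinAt
  have h2 : AnalyticAt ℂ Complex.Gamma (x : ℂ) :=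
    h1.analyticAt ((isOpen_lt continuous_const Complex.continuous_re).mem_nhds (by simpa using hx))
  -- The exponent `⊤` is the analytic level `ω`, so analyticity on the real line can be recovered
  -- from it.
  have h3 : ContDiffAt ℝ ⊤ (fun x : ℝ => (Complex.Gamma x).re) x :=
    ContDiffAt.real_of_complex (n := ⊤) h2.contDiffAt
  have h4 : (fun x : ℝ => (Complex.Gamma x).re) = Real.Gamma := by
    funext y; rw [Complex.Gamma_ofReal, Complex.ofReal_re]
  rw [h4] at h3
  exact h3.analyticAt

theorem analyticAt_logDeriv_Gamma {x : ℝ} (hx : 0 < x) :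
    AnalyticAt ℝ (logDeriv Real.Gamma) x :=
  (analyticAt_Gamma hx).deriv.div (analyticAt_Gamma hx) (Real.Gamma_pos_of_pos hx).ne'

theorem logDeriv_Gamma_add_one {x : ℝ} (hx : 0 < x) :
    logDeriv Real.Gamma (x + 1) = logDeriv Real.Gamma x + 1 / x := by
  have h1 : (fun y => Real.Gamma (y + 1)) =ᶠ[𝓝 x] fun y => y * Real.Gamma y := by
    filter_upwards [lt_mem_nhds hx] with y hy using Real.Gamma_add_one hy.ne'
  have h2 := h1.deriv_eq
  have h3 := (analyticAt_Gamma hx).differentiableAt.hasDerivAt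
  have h5 : HasDerivAt (fun y => y * Real.Gamma y) _ x := (hasDerivAt_id' x).mul h3
  rw [deriv_comp_add_const, h5.deriv] at h2
  have h4 := (Real.Gamma_pos_of_pos hx).ne'
  rw [logDeriv_apply, logDeriv_apply, h2, Real.Gamma_add_one hx.ne']
  field_simp
  ring

theorem logDeriv_Gamma_add_nat {x : ℝ} (hx : 0 < x) (N : ℕ) :
    logDeriv Real.Gamma (x + N) = logDeriv Real.Gamma x + ∑ n ∈ Finset.range N, 1 / (x + n) := by
  induction N with
  | zero => simp
  | succ N ih =>
    rw [Finset.sum_range_succ, ← add_assoc, ← ih, ← logDeriv_Gamma_add_one (by positivity)]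
    push_cast
    ring_nf

theorem monotoneOn_logDeriv_Gamma : MonotoneOn (logDeriv Real.Gamma) (Ioi 0) := by
  have hd : ∀ x ∈ Ioi (0 : ℝ),
      HasDerivAt (Real.log ∘ Real.Gamma) (logDeriv Real.Gamma x) x := fun x hx =>
    (analyticAt_Gamma hx).differentiableAt.hasDerivAt.log (Real.Gamma_pos_of_pos hx).ne'
  have h := Real.convexOn_log_Gamma.monotoneOn_deriv fun x hx => (hd x hx).differentiableAt
  intro x hx y hy hxy
  have := h hx hy hxy
  rwa [(hd x hx).deriv, (hd y hy).deriv] at this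

/-- The series `∑ (1 / (x + n) ^ (m + 1) - 1 / (x + n + 1 / 2) ^ (m + 1))`. -/
def stepSeries (m : ℕ) (x : ℝ) : ℝ :=
  ∑' n : ℕ, (1 / (x + n) ^ (m + 1) - 1 / (x + n + 1 / 2) ^ (m + 1))

theorem stepTerm_nonneg (m n : ℕ) {x : ℝ} (hx : 0 < x) :
    0 ≤ 1 / (x + n) ^ (m + 1) - 1 / (x + n + 1 / 2) ^ (m + 1) := by
  rw [sub_nonneg]
  exact one_div_le_one_div_of_le (by positivity)
    (pow_le_pow_left₀ (by positivity) (by linarith) _)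

/-- The recurrence of ψ telescopes both sums. The remainder ψ(x+1/2+N) - ψ(x+N) lies between 0 and
1/(x+N), because ψ is monotone by the log-convexity of Γ. -/
theorem hasSum_stepSeries_zero {x : ℝ} (hx : 0 < x) :
    HasSum (fun n : ℕ => 1 / (x + n) ^ (0 + 1) - 1 / (x + n + 1 / 2) ^ (0 + 1))
      (logDeriv Real.Gamma (x + 1 / 2) - logDeriv Real.Gamma x) := by
  rw [hasSum_iff_tendsto_nat_of_nonneg fun n => stepTerm_nonneg 0 n hx]
  have hfin : ∀ N : ℕ, ∑ n ∈ Finset.range N,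
      (1 / (x + n) ^ (0 + 1) - 1 / (x + n + 1 / 2) ^ (0 + 1))
      = (logDeriv Real.Gamma (x + 1 / 2) - logDeriv Real.Gamma x)
        - (logDeriv Real.Gamma (x + 1 / 2 + N) - logDeriv Real.Gamma (x + N)) := by
    intro N
    rw [logDeriv_Gamma_add_nat hx, logDeriv_Gamma_add_nat (by positivity), Finset.sum_sub_distrib]
    simp only [zero_add, pow_one, add_right_comm x _ (1 / 2 : ℝ)]
    ring
  simp only [hfin]
  have hz : Tendsto (fun N : ℕ => logDeriv Real.Gamma (x + 1 / 2 + N) - logDeriv Real.Gamma (x + N))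
      atTop (𝓝 0) := by
    refine squeeze_zero (g := fun N : ℕ => 1 / (x + N)) (fun N => ?_) (fun N => ?_) ?_
    · refine sub_nonneg.2 (monotoneOn_logDeriv_Gamma ?_ ?_ ?_)
      · exact (by positivity : 0 < x + N)
      · exact (by positivity : 0 < x + 1 / 2 + N)
      · linarith
    · rw [sub_le_iff_le_add, add_comm (1 / _), ← logDeriv_Gamma_add_one (by positivity)]
      refine monotoneOn_logDeriv_Gamma ?_ ?_ ?_
      · exact (by positivity : 0 < x + 1 / 2 + N)
      · exact (by positivity : 0 < x + N + 1)
      · linarith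
    · exact tendsto_const_nhds.div_atTop
        (tendsto_atTop_add_const_left _ _ tendsto_natCast_atTop_atTop)
  simpa using hz.const_sub (logDeriv Real.Gamma (x + 1 / 2) - logDeriv Real.Gamma x)

theorem summable_one_div_add_pow {x : ℝ} (hx : 0 < x) (m : ℕ) :
    Summable fun n : ℕ => 1 / (x + n) ^ (m + 2) := by
  rw [← summable_nat_add_iff 1]
  refine Summable.of_nonneg_of_le (fun n => by positivity) (fun n => ?_)
    ((summable_nat_add_iff 1).2 (Real.summable_one_div_nat_pow.2 (by omega : 1 < m + 2)))
  exact one_div_le_one_div_of_le (by positivity)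
    (pow_le_pow_left₀ (by positivity) (by linarith) _)

theorem summable_stepSeries {x : ℝ} (hx : 0 < x) (m : ℕ) :
    Summable fun n : ℕ => 1 / (x + n) ^ (m + 1) - 1 / (x + n + 1 / 2) ^ (m + 1) := by
  rcases m with _ | m
  · exact (hasSum_stepSeries_zero hx).summable
  · refine Summable.of_nonneg_of_le (fun n => stepTerm_nonneg _ n hx) (fun n => ?_)
      (summable_one_div_add_pow hx m)
    have : 0 ≤ 1 / (x + n + 1 / 2) ^ (m + 1 + 1) := by positivity
    linarith

theorem hasDerivAt_stepSeries (m : ℕ) {x : ℝ} (hx : 0 < x) :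
    HasDerivAt (stepSeries m) (-(m + 1) * stepSeries (m + 1) x) x := by
  have hx2 : 0 < x / 2 := by positivity
  have hp : ∀ (n : ℕ) (y c : ℝ), y + n + c ≠ 0 →
      HasDerivAt (fun y : ℝ => 1 / (y + n + c) ^ (m + 1))
        (-(m + 1) * (1 / (y + n + c) ^ (m + 1 + 1))) y := by
    intro n y c hy
    have h1 : HasDerivAt (fun y : ℝ => y + n + c) 1 y :=
      ((hasDerivAt_id y).add_const _).add_const _
    refine ((hasDerivAt_const y (1 : ℝ)).div (h1.pow (m + 1)) (pow_ne_zero _ hy)).congr_deriv ?_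
    simp only [Pi.pow_apply, Nat.add_sub_cancel]
    push_cast
    field_simp
    ring
  have key := hasDerivAt_tsum_of_isPreconnected (𝕜 := ℝ) (F := ℝ)
    (g := fun (n : ℕ) (y : ℝ) => 1 / (y + n) ^ (m + 1) - 1 / (y + n + 1 / 2) ^ (m + 1))
    (g' := fun (n : ℕ) (y : ℝ) =>
      -(m + 1) * (1 / (y + n) ^ (m + 1 + 1) - 1 / (y + n + 1 / 2) ^ (m + 1 + 1)))
    -- Staying above x/2 bounds the differentiated terms uniformly by a convergent series.
    (t := Ioi (x / 2)) (y₀ := x) (y := x)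
    ((summable_one_div_add_pow hx2 m).mul_left ((m : ℝ) + 1)) isOpen_Ioi isPreconnected_Ioi
    (fun n y hy => ?_) (fun n y hy => ?_) (by simpa using hx) (summable_stepSeries hx m)
    (by simpa using hx)
  · have h : -((m : ℝ) + 1) * stepSeries (m + 1) x = ∑' n : ℕ, -((m : ℝ) + 1) *
        (1 / (x + n) ^ (m + 1 + 1) - 1 / (x + n + 1 / 2) ^ (m + 1 + 1)) := by
      rw [tsum_mul_left]; rfl
    rw [h]
    exact key
  · have hy0 : 0 < y := hx2.trans hy
    have h1 := hp n y 0 (by positivity)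
    simp only [add_zero] at h1
    exact (h1.sub (hp n y (1 / 2) (by positivity))).congr_deriv (by ring)
  · have hy' : x / 2 < y := hy
    have hy0 : 0 < y := hx2.trans hy
    rw [norm_mul, norm_neg, Real.norm_of_nonneg (by positivity),
      Real.norm_of_nonneg (stepTerm_nonneg (m + 1) n hy0)]
    gcongr
    calc 1 / (y + n) ^ (m + 1 + 1) - 1 / (y + n + 1 / 2) ^ (m + 1 + 1)
        ≤ 1 / (y + n) ^ (m + 1 + 1) := sub_le_self _ (by positivity)
      _ ≤ 1 / (x / 2 + n) ^ (m + 2) := by gcongr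

theorem iteratedDeriv_eq_stepSeries (m : ℕ) {x : ℝ} (hx : 0 < x) :
    iteratedDeriv m (fun x => logDeriv Real.Gamma (x + 1 / 2) - logDeriv Real.Gamma x) x
      = (-1) ^ m * (m.factorial : ℝ) * stepSeries m x := by
  induction m generalizing x with
  | zero =>
    rw [iteratedDeriv_zero, stepSeries, (hasSum_stepSeries_zero hx).tsum_eq]
    simp
  | succ m ih =>
    rw [iteratedDeriv_succ]
    have h : iteratedDeriv m
        (fun x => logDeriv Real.Gamma (x + 1 / 2) - logDeriv Real.Gamma x) =ᶠ[𝓝 x]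
        fun x => (-1) ^ m * (m.factorial : ℝ) * stepSeries m x := by
      filter_upwards [lt_mem_nhds hx] with y hy using ih hy
    rw [h.deriv_eq, ((hasDerivAt_stepSeries m hx).const_mul _).deriv, Nat.factorial_succ, pow_succ]
    push_cast
    ring

theorem polygamma_half_step (m : ℕ) {x : ℝ} (hx : 0 < x) :
    polygamma m (x + 1 / 2) - polygamma m x = (-1) ^ m * (m.factorial : ℝ) * stepSeries m x := by
  rw [← iteratedDeriv_eq_stepSeries m hx]
  have h1 : ContDiffAt ℝ m (logDeriv Real.Gamma) x := (analyticAt_logDeriv_Gamma hx).contDiffAt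
  have h2 : ContDiffAt ℝ m (logDeriv Real.Gamma) (x + 1 / 2) :=
    (analyticAt_logDeriv_Gamma (by positivity)).contDiffAt
  have h3 : ContDiffAt ℝ m (fun x => logDeriv Real.Gamma (x + 1 / 2)) x :=
    ContDiffAt.comp (g := logDeriv Real.Gamma) (f := fun x : ℝ => x + 1 / 2) x h2
      (contDiffAt_id.add contDiffAt_const)
  have h4 := iteratedDeriv_sub h3 h1
  have h5 := congrFun (iteratedDeriv_comp_add_const m (logDeriv Real.Gamma) (1 / 2)) x
  simp only [polygamma]
  rw [← h5, ← h4]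
  rfl

theorem hasSum_stepSeries (m : ℕ) {x : ℝ} (hx : 0 < x) :
    HasSum (fun n : ℕ => 1 / (x + n) ^ (m + 1) - 1 / (x + n + 1 / 2) ^ (m + 1))
      (stepSeries m x) :=
  (summable_stepSeries hx m).hasSum

end Polygamma

/-! ### The recurrence increment in closed form -/

/-- The value of `∑ 2 (-1) ^ n / ((2 n + 1) (2 n + s) ^ 3)`. -/
def stepValue (s : ℝ) : ℝ :=
  2 * ((Real.pi / 4 - (polygamma 0 (s / 4 + 1 / 2) - polygamma 0 (s / 4)) / 4) / (s - 1) ^ 3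
    + (polygamma 1 (s / 4 + 1 / 2) - polygamma 1 (s / 4)) / (16 * (s - 1) ^ 2)
    - (polygamma 2 (s / 4 + 1 / 2) - polygamma 2 (s / 4)) / (128 * (s - 1)))

theorem hasSum_leibniz_pairs :
    HasSum (fun n : ℕ => 1 / (4 * (n : ℝ) + 1) - 1 / (4 * (n : ℝ) + 3)) (Real.pi / 4) := by
  rw [hasSum_iff_tendsto_nat_of_nonneg fun n => by
    rw [sub_nonneg]; gcongr; norm_num]
  have h2 : Tendsto (fun n : ℕ => 2 * n) atTop atTop := tendsto_id.const_mul_atTop' two_pos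
  refine (Real.tendsto_sum_pi_div_four.comp h2).congr fun N => ?_
  simp only [Function.comp_apply]
  induction N with
  | zero => simp
  | succ N ih =>
    rw [show 2 * (N + 1) = 2 * N + 1 + 1 by ring, Finset.sum_range_succ, Finset.sum_range_succ, ih,
      Finset.sum_range_succ, (even_two_mul N).neg_one_pow, (odd_two_mul_add_one N).neg_one_pow]
    push_cast
    ring_nf

theorem hasSum_stepValue {s : ℝ} (hs : 1 < s) :
    HasSum (fun n : ℕ => 2 * (-1 : ℝ) ^ n / ((2 * (n : ℝ) + 1) * (2 * (n : ℝ) + s) ^ 3))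
      (stepValue s) := by
  set f : ℕ → ℝ := fun n => 2 * (-1 : ℝ) ^ n / ((2 * (n : ℝ) + 1) * (2 * (n : ℝ) + s) ^ 3) with hf
  have hsum : Summable f := by
    refine Summable.of_norm_bounded (((summable_nat_add_iff 1).2
      (Real.summable_one_div_nat_pow.2 (by norm_num : 1 < 3))).mul_left 2) fun n => ?_
    have hn : (0 : ℝ) ≤ n := n.cast_nonneg
    simp only [hf]
    rw [norm_div, norm_mul, norm_pow, norm_neg, norm_one, one_pow, mul_one,
      Real.norm_of_nonneg (by norm_num), Real.norm_of_nonneg (by positivity), ← mul_one_div]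
    push_cast
    gcongr
    calc ((n : ℝ) + 1) ^ 3 ≤ (2 * (n : ℝ) + s) ^ 3 := by gcongr; linarith
      _ ≤ (2 * (n : ℝ) + 1) * (2 * (n : ℝ) + s) ^ 3 :=
        le_mul_of_one_le_left (by positivity) (by linarith)
  have he : HasSum (fun n => f (2 * n)) _ :=
    (hsum.comp_injective (mul_right_injective₀ two_ne_zero)).hasSum
  have ho : HasSum (fun n => f (2 * n + 1)) _ :=
    (hsum.comp_injective (i := fun n => 2 * n + 1) fun a b h => by simpa using h).hasSum
  have htot := he.even_add_odd ho
  -- Pairing even and odd indices replaces the alternating sign by differences of terms with step 4,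
  -- which match Leibniz pairs and step series at s/4.
  suffices h : HasSum (fun n => f (2 * n) + f (2 * n + 1)) (stepValue s) by
    rw [h.unique (he.add ho)]
    exact htot
  have hs4 : 0 < s / 4 := by linarith
  have hc : s - 1 ≠ 0 := by linarith
  have h := (((hasSum_leibniz_pairs.sub ((hasSum_stepSeries 0 hs4).div_const 4)).div_const
    ((s - 1) ^ 3)).sub (((hasSum_stepSeries 1 hs4).div_const (16 * (s - 1) ^ 2)).add
    ((hasSum_stepSeries 2 hs4).div_const (64 * (s - 1))))).mul_left 2
  have hval : stepValue s = 2 * ((Real.pi / 4 - stepSeries 0 (s / 4) / 4) / (s - 1) ^ 3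
      - (stepSeries 1 (s / 4) / (16 * (s - 1) ^ 2) + stepSeries 2 (s / 4) / (64 * (s - 1)))) := by
    rw [stepValue, polygamma_half_step 0 hs4, polygamma_half_step 1 hs4, polygamma_half_step 2 hs4]
    simp only [Nat.factorial]
    field_simp
    push_cast
    ring
  rw [hval]
  refine hasSum_of_eq h fun n => ?_
  have hn : (0 : ℝ) ≤ n := n.cast_nonneg
  have a1 : 4 * (n : ℝ) + 1 ≠ 0 := by positivity
  have a2 : 4 * (n : ℝ) + 3 ≠ 0 := by positivity
  have a3 : 4 * (n : ℝ) + s ≠ 0 := by positivity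
  have a4 : 4 * (n : ℝ) + (s + 2) ≠ 0 := by positivity
  have b3 : s / 4 + (n : ℝ) = (4 * n + s) / 4 := by ring
  have b4 : (4 * (n : ℝ) + s) / 4 + 1 / 2 = (4 * n + (s + 2)) / 4 := by ring
  have pf : ∀ y : ℝ, y ≠ 0 → y + (s - 1) ≠ 0 → 1 / (y * (y + (s - 1)) ^ 3)
      = (1 / y - 1 / (y + (s - 1))) / (s - 1) ^ 3 - 1 / ((y + (s - 1)) ^ 2 * (s - 1) ^ 2)
        - 1 / ((y + (s - 1)) ^ 3 * (s - 1)) := by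
    intro y hy hy2
    field_simp
    ring
  have p1 := pf (4 * (n : ℝ) + 1) a1 (by rw [show 4 * (n : ℝ) + 1 + (s - 1) = 4 * n + s by ring]; exact a3)
  have p2 := pf (4 * (n : ℝ) + 3) a2
    (by rw [show 4 * (n : ℝ) + 3 + (s - 1) = 4 * n + (s + 2) by ring]; exact a4)
  rw [show 4 * (n : ℝ) + 1 + (s - 1) = 4 * n + s by ring] at p1
  rw [show 4 * (n : ℝ) + 3 + (s - 1) = 4 * n + (s + 2) by ring] at p2
  have q1 : f (2 * n) = 2 * (1 / ((4 * (n : ℝ) + 1) * (4 * n + s) ^ 3)) := by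
    simp only [hf]
    rw [(even_two_mul n).neg_one_pow]
    push_cast
    ring_nf
  have q2 : f (2 * n + 1) = -(2 * (1 / ((4 * (n : ℝ) + 3) * (4 * n + (s + 2)) ^ 3))) := by
    simp only [hf]
    rw [(odd_two_mul_add_one n).neg_one_pow]
    push_cast
    ring_nf
  rw [q1, q2, p1, p2, b3, b4]
  field_simp
  ring

/-! ### The double series and the recurrence in t -/

/-- The general term of the double series. -/
def doubleTerm (t : ℝ) (p : ℕ × ℕ) : ℝ :=
  (-1 : ℝ) ^ (p.1 + p.2) * milgram 0 p.1 /
    (((p.1 : ℝ) + 1 / 2) * (2 * (p.1 : ℝ) + 2 * (p.2 : ℝ) + t) ^ 3)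

/-- With a² = n+1 and b² = m+1, the cubed factor is at least ab, so its cube absorbs a³b³. -/
theorem summable_doubleTerm {t : ℝ} (ht : 2 ≤ t) : Summable (doubleTerm t) := by
  have hs := summable_one_div_mul_sqrt
  have h := (summable_mul_of_summable_norm hs.norm hs.norm).mul_left 2
  refine Summable.of_norm_bounded h fun ⟨n, m⟩ => ?_
  have hn0 : (0 : ℝ) ≤ n := n.cast_nonneg
  have hm0 : (0 : ℝ) ≤ m := m.cast_nonneg
  simp only [doubleTerm, milgram, mul_one]
  rw [norm_div, norm_pow, norm_neg, norm_one, one_pow, Real.norm_of_nonneg (by positivity)]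
  set a := √((n : ℝ) + 1)
  set b := √((m : ℝ) + 1)
  have ha : a ^ 2 = (n : ℝ) + 1 := Real.sq_sqrt (by positivity)
  have hb : b ^ 2 = (m : ℝ) + 1 := Real.sq_sqrt (by positivity)
  have ha0 : 0 < a := Real.sqrt_pos.2 (by positivity)
  have hb0 : 0 < b := Real.sqrt_pos.2 (by positivity)
  rw [← ha, ← hb, one_div_mul_one_div, mul_one_div,
    div_le_div_iff₀ (mul_pos (by positivity) (by positivity)) (by positivity), one_mul]
  have h1 : a * b ≤ 2 * (n : ℝ) + 2 * (m : ℝ) + t := by nlinarith [sq_nonneg (a - b)]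
  calc a ^ 2 * a * (b ^ 2 * b) = 1 * (a * b) ^ 3 := by ring
    _ ≤ (2 * ((n : ℝ) + 1 / 2)) * (2 * (n : ℝ) + 2 * (m : ℝ) + t) ^ 3 := by
        gcongr; linarith
    _ = _ := by ring

theorem hasSum_oddHarmonic_of_doubleTerm {t : ℝ} (ht : 2 ≤ t) :
    HasSum (fun n : ℕ => (-1 : ℝ) ^ n * (2 * oddHarmonic (n + 1)) / (2 * (n : ℝ) + t) ^ 3)
      (∑' p, doubleTerm t p) := by
  refine hasSum_of_eq (hasSum_antidiagonal (summable_doubleTerm ht)) fun N => ?_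
  rw [Finset.Nat.sum_antidiagonal_eq_sum_range_succ_mk, oddHarmonic, Finset.mul_sum,
    Finset.mul_sum, Finset.sum_div]
  refine Finset.sum_congr rfl fun i hi => ?_
  have hi' : i ≤ N := Nat.lt_succ_iff.1 (Finset.mem_range.1 hi)
  have h1 : 2 * (i : ℝ) + 1 ≠ 0 := by positivity
  have h2 : (i : ℝ) + 1 / 2 = (2 * i + 1) / 2 := by ring
  have h3 : 2 * (i : ℝ) + 2 * ((N : ℝ) - i) + t = 2 * N + t := by ring
  simp only [doubleTerm, milgram]
  rw [Nat.add_sub_cancel' hi', Nat.cast_sub hi', h2, h3]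
  field_simp

theorem double_series_of_hasSum {t S : ℝ} (ht : 2 ≤ t)
    (hS : HasSum (fun n : ℕ => (-1 : ℝ) ^ n * (2 * oddHarmonic (n + 1)) / (2 * (n : ℝ) + t) ^ 3) S) :
    (∀ n, Summable fun j => doubleTerm t (n, j)) ∧
      HasSum (fun n => ∑' j, doubleTerm t (n, j)) S := by
  have hs := summable_doubleTerm ht
  refine ⟨hs.prod_factor, ?_⟩
  rw [hS.unique (hasSum_oddHarmonic_of_doubleTerm ht)]
  exact hs.hasSum.prod_fiberwise fun n => (hs.prod_factor n).hasSum

/-- Splitting h_{n+1} = h_n + 1/(2n+1) separates the closed-form series; in the rest the term n = 0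
vanishes as h_0 = 0, and the shift n ↦ n+1 flips the sign. -/
theorem hasSum_oddHarmonic_add_two {t S : ℝ} (ht : 1 < t)
    (hS : HasSum (fun n : ℕ => (-1 : ℝ) ^ n * (2 * oddHarmonic (n + 1)) / (2 * (n : ℝ) + t) ^ 3) S) :
    HasSum (fun n : ℕ => (-1 : ℝ) ^ n * (2 * oddHarmonic (n + 1)) / (2 * (n : ℝ) + (t + 2)) ^ 3)
      (stepValue t - S) := by
  have h := (hasSum_stepValue ht).sub hS
  have h2 : HasSum (fun n : ℕ => -((-1 : ℝ) ^ n * (2 * oddHarmonic n) / (2 * (n : ℝ) + t) ^ 3))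
      (stepValue t - S) := by
    refine hasSum_of_eq h fun n => ?_
    have e1 : oddHarmonic (n + 1) = oddHarmonic n + 1 / (2 * (n : ℝ) + 1) := by
      rw [oddHarmonic, Finset.sum_range_succ, ← oddHarmonic]
    have h1 : 2 * (n : ℝ) + 1 ≠ 0 := by positivity
    rw [e1]
    field_simp
    ring
  rw [← hasSum_nat_add_iff' 1] at h2
  have e0 : oddHarmonic 0 = 0 := by simp [oddHarmonic]
  simp only [Finset.sum_range_one, e0, mul_zero, zero_div, neg_zero, sub_zero] at h2
  refine hasSum_of_eq h2 fun n => ?_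
  push_cast
  rw [pow_succ, show 2 * ((n : ℝ) + 1) + t = 2 * n + (t + 2) by ring]
  ring

theorem hasSum_oddHarmonic_shift {t C : ℝ} (ht : 1 < t)
    (hC : HasSum (fun n : ℕ => (-1 : ℝ) ^ n * (2 * oddHarmonic (n + 1)) / (2 * (n : ℝ) + t) ^ 3) C)
    (k : ℕ) :
    HasSum (fun n : ℕ => (-1 : ℝ) ^ n * (2 * oddHarmonic (n + 1)) /
        (2 * (n : ℝ) + (t + 2 * k)) ^ 3)
      (∑ j ∈ Finset.Icc 1 k, (-1 : ℝ) ^ (j + 1) * stepValue (t + 2 * ((k : ℝ) - j))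
        + (-1) ^ k * C) := by
  induction k with
  | zero => simpa using hC
  | succ k ih =>
    have h := hasSum_oddHarmonic_add_two (by linarith [(k.cast_nonneg : (0 : ℝ) ≤ k)]) ih
    rw [show t + 2 * (k : ℝ) + 2 = t + 2 * ((k + 1 : ℕ) : ℝ) by push_cast; ring] at h
    have hI : ∀ (m : ℕ) (f : ℕ → ℝ), ∑ j ∈ Finset.Icc 1 m, f j = ∑ i ∈ Finset.range m, f (i + 1) :=
      fun m f => by
        rw [Finset.range_eq_Ico, Finset.sum_Ico_add' f 0 m 1, zero_add]
        rfl
    have hval : stepValue (t + 2 * (k : ℝ)) - (∑ j ∈ Finset.Icc 1 k,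
        (-1 : ℝ) ^ (j + 1) * stepValue (t + 2 * ((k : ℝ) - j)) + (-1) ^ k * C)
        = ∑ j ∈ Finset.Icc 1 (k + 1),
          (-1 : ℝ) ^ (j + 1) * stepValue (t + 2 * (((k + 1 : ℕ) : ℝ) - j)) + (-1) ^ (k + 1) * C := by
      rw [hI, hI, Finset.sum_range_succ']
      have e : ∑ i ∈ Finset.range k, (-1 : ℝ) ^ (i + 1 + 1 + 1) *
          stepValue (t + 2 * (((k + 1 : ℕ) : ℝ) - ((i + 1 + 1 : ℕ) : ℝ)))
          = -∑ i ∈ Finset.range k, (-1 : ℝ) ^ (i + 1 + 1) *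
            stepValue (t + 2 * ((k : ℝ) - ((i + 1 : ℕ) : ℝ))) := by
        rw [← Finset.sum_neg_distrib]
        refine Finset.sum_congr rfl fun i _ => ?_
        rw [show ((k + 1 : ℕ) : ℝ) - ((i + 1 + 1 : ℕ) : ℝ) = (k : ℝ) - ((i + 1 : ℕ) : ℝ) by
          push_cast; ring, pow_succ _ (i + 1 + 1)]
        ring
      rw [e]
      push_cast
      simp only [add_sub_cancel_right]
      ring
    rwa [hval] at h

theorem base_value_even :
    HasSum (fun n : ℕ => (-1 : ℝ) ^ n * (2 * oddHarmonic (n + 1)) / (2 * (n : ℝ) + 2) ^ 3)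
      (-oddSeries ℝ 3 (-1) / 4) := by
  have h : HasSum (fun n : ℕ => oddHarmonic n / (n : ℝ) ^ 3 * (-1) ^ n) (oddSeries ℝ 3 (-1)) := by
    have : Summable fun n : ℕ => oddHarmonic n / (n : ℝ) ^ 3 * (-1) ^ n :=
      Summable.of_norm_bounded (summable_oddHarmonic_div (k := 3) (by norm_num)).norm
        fun n => by simp
    exact this.hasSum
  rw [← hasSum_nat_add_iff' 1] at h
  simp only [Finset.sum_range_one, oddHarmonic, Finset.range_zero, Finset.sum_empty, zero_div,
    zero_mul, sub_zero] at h
  refine hasSum_of_eq (h.neg.div_const 4) fun n => ?_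
  simp only [oddHarmonic]
  rw [show 2 * (n : ℝ) + 2 = 2 * ((n + 1 : ℕ) : ℝ) by push_cast; ring, mul_pow, pow_succ]
  ring

theorem base_value_odd :
    HasSum (fun n : ℕ => (-1 : ℝ) ^ n * (2 * oddHarmonic (n + 1)) / (2 * (n : ℝ) + 3) ^ 3)
      (7 * Real.pi / 64 * zetaValue 3 + dirichletBeta 4 - Real.pi ^ 3 / 16 * Real.log 2) := by
  have h := tsum_oddHarmonic_odd_cube
  rw [← hasSum_nat_add_iff' 1] at h
  have e0 : oddHarmonic 0 = 0 := by simp [oddHarmonic]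
  simp only [Finset.sum_range_one, e0, mul_zero, zero_div, sub_zero] at h
  refine hasSum_of_eq h fun n => ?_
  rw [show 2 * ((n + 1 : ℕ) : ℝ) + 1 = 2 * n + 3 by push_cast; ring, pow_succ, pow_succ]
  ring

end

end EulerSums

open EulerSums in
theorem theorem3p6 (k : ℕ) :
    (∃ S : ℝ,
      HasSum (fun n : ℕ =>
        (-1 : ℝ) ^ ((n + 1) + 1) * (2 * oddHarmonic (n + 1)) /
          (2 * ((n : ℝ) + 1) + 2 * (k : ℝ)) ^ 3) S ∧
      (∀ n : ℕ, Summable (fun j : ℕ =>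
        (-1 : ℝ) ^ (n + j) * milgram 0 n /
          (((n : ℝ) + 1 / 2) * (2 * (n : ℝ) + 2 * (j : ℝ) + 2 * (k : ℝ) + 2) ^ 3))) ∧
      HasSum (fun n : ℕ => ∑' j : ℕ,
        (-1 : ℝ) ^ (n + j) * milgram 0 n /
          (((n : ℝ) + 1 / 2) * (2 * (n : ℝ) + 2 * (j : ℝ) + 2 * (k : ℝ) + 2) ^ 3)) S ∧
      S =
        ∑ j ∈ Finset.Icc 1 k,
          (-1 : ℝ) ^ (j + 1) / (64 * (1 + 2 * (k : ℝ) - 2 * (j : ℝ)) ^ 3) *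
            (32 * Real.pi
              - 32 * polygamma 0 (((k : ℝ) + 2 - (j : ℝ)) / 2)
              + 32 * polygamma 0 ((1 + (k : ℝ) - (j : ℝ)) / 2)
              + 8 * (1 + 2 * (k : ℝ) - 2 * (j : ℝ)) *
                  polygamma 1 (((k : ℝ) + 2 - (j : ℝ)) / 2)
              - 8 * (1 + 2 * (k : ℝ) - 2 * (j : ℝ)) *
                  polygamma 1 ((1 + (k : ℝ) - (j : ℝ)) / 2)
              - (1 + 2 * (k : ℝ) - 2 * (j : ℝ)) ^ 2 *
                  (polygamma 2 (((k : ℝ) + 2 - (j : ℝ)) / 2)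
                    - polygamma 2 ((1 + (k : ℝ) - (j : ℝ)) / 2)))
        + (-1 : ℝ) ^ k *
            (1 / 2 *
                (11 / 4 * zetaValue 4
                  - 7 / 4 * zetaValue 3 * Real.log 2
                  + 1 / 2 * zetaValue 2 * Real.log 2 ^ 2
                  - 1 / 12 * Real.log 2 ^ 4
                  - 2 * polylog 4 (1 / 2))
              - 25 / 128 * zetaValue 4)) ∧
    (∃ S : ℝ,
      HasSum (fun n : ℕ =>
        (-1 : ℝ) ^ ((n + 1) + 1) * (2 * oddHarmonic (n + 1)) /
          (2 * ((n : ℝ) + 1) + 2 * (k : ℝ) + 1) ^ 3) S ∧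
      (∀ n : ℕ, Summable (fun j : ℕ =>
        (-1 : ℝ) ^ (n + j) * milgram 0 n /
          (((n : ℝ) + 1 / 2) * (2 * (n : ℝ) + 2 * (j : ℝ) + 2 * (k : ℝ) + 3) ^ 3))) ∧
      HasSum (fun n : ℕ => ∑' j : ℕ,
        (-1 : ℝ) ^ (n + j) * milgram 0 n /
          (((n : ℝ) + 1 / 2) * (2 * (n : ℝ) + 2 * (j : ℝ) + 2 * (k : ℝ) + 3) ^ 3)) S ∧
      S =
        ∑ j ∈ Finset.Icc 1 k,
          (-1 : ℝ) ^ (j + 1) *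
            (1 / (512 * (1 + (k : ℝ) - (j : ℝ)) ^ 3) *
              (32 * Real.pi
                - 32 * polygamma 0 ((2 * (k : ℝ) + 5 - 2 * (j : ℝ)) / 4)
                + 32 * polygamma 0 ((3 + 2 * (k : ℝ) - 2 * (j : ℝ)) / 4)
                + 16 * (1 + (k : ℝ) - (j : ℝ)) *
                    (polygamma 1 ((2 * (k : ℝ) + 5 - 2 * (j : ℝ)) / 4)
                      - polygamma 1 ((3 + 2 * (k : ℝ) - 2 * (j : ℝ)) / 4))
                - 4 * (1 + (k : ℝ) - (j : ℝ)) ^ 2 *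
                    (polygamma 2 ((2 * (k : ℝ) + 5 - 2 * (j : ℝ)) / 4)
                      - polygamma 2 ((3 + 2 * (k : ℝ) - 2 * (j : ℝ)) / 4))))
        + (-1 : ℝ) ^ k *
            (7 * Real.pi / 64 * zetaValue 3 + dirichletBeta 4
              - Real.pi ^ 3 / 16 * Real.log 2)) := by
  have hk0 : (0 : ℝ) ≤ k := k.cast_nonneg
  have h1 := hasSum_oddHarmonic_shift (by norm_num) base_value_even k
  have h2 := hasSum_oddHarmonic_shift (by norm_num) base_value_odd k
  have d1 := double_series_of_hasSum (by linarith) h1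
  have d2 := double_series_of_hasSum (by linarith) h2
  have e1 : ∀ n j : ℕ, (-1 : ℝ) ^ (n + j) * milgram 0 n /
      (((n : ℝ) + 1 / 2) * (2 * (n : ℝ) + 2 * (j : ℝ) + 2 * (k : ℝ) + 2) ^ 3)
      = doubleTerm (2 + 2 * k) (n, j) := fun n j => by
    simp only [doubleTerm]
    rw [show 2 * (n : ℝ) + 2 * (j : ℝ) + 2 * (k : ℝ) + 2 = 2 * n + 2 * j + (2 + 2 * k) by ring]
  have e2 : ∀ n j : ℕ, (-1 : ℝ) ^ (n + j) * milgram 0 n /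
      (((n : ℝ) + 1 / 2) * (2 * (n : ℝ) + 2 * (j : ℝ) + 2 * (k : ℝ) + 3) ^ 3)
      = doubleTerm (3 + 2 * k) (n, j) := fun n j => by
    simp only [doubleTerm]
    rw [show 2 * (n : ℝ) + 2 * (j : ℝ) + 2 * (k : ℝ) + 3 = 2 * n + 2 * j + (3 + 2 * k) by ring]
  simp only [e1, e2]
  refine ⟨⟨_, hasSum_of_eq h1 fun n => ?_, d1.1, d1.2, ?_⟩,
    ⟨_, hasSum_of_eq h2 fun n => ?_, d2.1, d2.2, ?_⟩⟩
  · rw [show 2 * ((n : ℝ) + 1) + 2 * (k : ℝ) = 2 * n + (2 + 2 * k) by ring, pow_succ, pow_succ]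
    ring
  · rw [oddSeries_three_neg_one_eq]
    congr 1
    refine Finset.sum_congr rfl fun j hj => ?_
    have hj' : (j : ℝ) ≤ k := by exact_mod_cast (Finset.mem_Icc.1 hj).2
    -- This is s - 1 for the increment at s = 2 + 2(k-j); it is at least 1 since j ≤ k.
    have hc : 1 + 2 * (k : ℝ) - 2 * j ≠ 0 := by linarith
    rw [stepValue, show 2 + 2 * ((k : ℝ) - j) - 1 = 1 + 2 * k - 2 * j by ring,
      show (2 + 2 * ((k : ℝ) - j)) / 4 = (1 + k - j) / 2 by ring,
      show (1 + (k : ℝ) - j) / 2 + 1 / 2 = (k + 2 - j) / 2 by ring]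
    field_simp
    ring
  · rw [show 2 * ((n : ℝ) + 1) + 2 * (k : ℝ) + 1 = 2 * n + (3 + 2 * k) by ring, pow_succ, pow_succ]
    ring
  · congr 1
    refine Finset.sum_congr rfl fun j hj => ?_
    have hj' : (j : ℝ) ≤ k := by exact_mod_cast (Finset.mem_Icc.1 hj).2
    have hc : 1 + (k : ℝ) - j ≠ 0 := by linarith
    rw [stepValue, show 3 + 2 * ((k : ℝ) - j) - 1 = 2 * (1 + k - j) by ring,
      show (3 + 2 * ((k : ℝ) - j)) / 4 = (3 + 2 * k - 2 * j) / 4 by ring,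
      show (3 + 2 * (k : ℝ) - 2 * j) / 4 + 1 / 2 = (2 * k + 5 - 2 * j) / 4 by ring]
    field_simp
    ring
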